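/- Let $\mathbb{N}_{\max} = \mathbb{N}\cup\{-\infty\}$ with the operations $\max$ and $+$. A max-plus automaton $\mathcal{A}$ over a finite alphabet $\Sigma$ consists of a finite set of states $Q$, a matrix $M(a)\in\mathbb{N}_{\max}^{Q\times Q}$ for each $a\in\Sigma$, a row vector $I\in\mathbb{N}_{\max}^{Q}$ and a column vector $F\in\mathbb{N}_{\max}^{Q}$. It computes the function $[\![\mathcal{A}]\!]:\Sigma^*\to\mathbb{N}_{\max}$, $[\![\mathcal{A}]\!](w_1\cdots w_k)= I\otimes M(w_1)\otimes\cdots\otimes M(w_k)\otimes F$, where $\otimes$ is the max-plus matrix product. The automaton is deterministic if $I$, and each row of each $M(a)$, has at most one entry different from $-\infty$; it is trim if every state is accessible from an initial state and co-accessible (can reach a final state), where a state $q$ is initial if $I_q\neq-\infty$ and final if $F_q\neq-\infty$. For automata $\mathcal{A},\mathcal{B}$ over the same alphabet, $\mathcal{A}$ is big-O of $\mathcal{B}$ if there is a positive integer $c$ such that $[\![\mathcal{A}]\!](w)\le c\,[\![\mathcal{B}]\!](w)+c$ for all $w\in\Sigma^*$. The big-O problem asks, given max-plus automata $\mathcal{A},\mathcal{B}$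 over the same finite alphabet (finite weights being written in binary), whether $\mathcal{A}$ is big-O of $\mathcal{B}$. The simplified big-O problem is its restriction to the inputs in which $\mathcal{A}$ and $\mathcal{B}$ are trim, $\mathcal{A}$ is deterministic, and $[\![\mathcal{B}]\!](w)\neq-\infty$ for all words $w$. A problem is decidable in PSPACE if some deterministic Turing machine (multi-stack), on the encoding of every input of the problem, uses space polynomial in the length of the encoding, halts, and accepts exactly the yes-inputs. **Proposition.** If the simplified big-O problem is decidable in PSPACE, then the big-O problem (for arbitrary max-plus automata, trim or not) is decidable in PSPACE. -/

import Mathlib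

/-- `ℕ ∪ {-∞}`, with `⊥` playing the role of `-∞`. The semiring operations are `max` (`⊔`, with
neutral element `⊥`) and `+` (with `⊥ + x = x + ⊥ = ⊥`). -/
abbrev NMax : Type := WithBot ℕ

/-- The max-plus product of matrices: `(X ⊗ Y) p r = max_q (X p q + Y q r)`. -/
def mpMul {Q : Type} [Fintype Q] (X Y : Matrix Q Q NMax) : Matrix Q Q NMax :=
  fun p r => Finset.univ.sup fun q => X p q + Y q r

/-- The max-plus identity matrix: `0` on the diagonal and `-∞` elsewhere. -/
def mpOne {Q : Type} [DecidableEq Q] : Matrix Q Q NMax :=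
  fun p q => if p = q then 0 else ⊥

/-- A max-plus automaton with set of states `Q` over the alphabet `S`. -/
structure MaxPlusAutomaton (Q S : Type) where
  /-- the transition matrix of each letter -/
  M : S → Matrix Q Q NMax
  /-- the initial row vector -/
  I : Q → NMax
  /-- the final column vector -/
  F : Q → NMax

namespace MaxPlusAutomaton

variable {Q P S : Type} [Fintype Q] [DecidableEq Q] [Fintype P] [DecidableEq P]

/-- The extension of `M` to words by morphism: `M(w₁ ⋯ w_k) = M(w₁) ⊗ ⋯ ⊗ M(w_k)`. -/
def wordMatrix (A : MaxPlusAutomaton Q S) : List S → Matrix Q Q NMax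
  | [] => mpOne
  | a :: w => mpMul (A.M a) (A.wordMatrix w)

/-- The weighting function `⟦A⟧(w) = I ⊗ M(w) ⊗ F`. -/
def weight (A : MaxPlusAutomaton Q S) (w : List S) : NMax :=
  Finset.univ.sup fun p => Finset.univ.sup fun q => A.I p + A.wordMatrix w p q + A.F q

/-- `A` is deterministic: `I`, and every row of every `M(a)`, has at most one entry `≠ -∞`. -/
def IsDeterministic (A : MaxPlusAutomaton Q S) : Prop :=
  (∀ p q, A.I p ≠ ⊥ → A.I q ≠ ⊥ → p = q) ∧
    ∀ a p q r, A.M a p q ≠ ⊥ → A.M a p r ≠ ⊥ → q = r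

/-- Every state can be reached from an initial state and can reach a final state. -/
def IsTrim (A : MaxPlusAutomaton Q S) : Prop :=
  ∀ q, (∃ w p, A.I p ≠ ⊥ ∧ A.wordMatrix w p q ≠ ⊥) ∧
    ∃ w p, A.wordMatrix w q p ≠ ⊥ ∧ A.F p ≠ ⊥

/-- `A` is big-O of `B`: for some positive integer `c`, `⟦A⟧(w) ≤ c ⟦B⟧(w) + c` for all words `w`
(here `c * ⊥ = ⊥`, as `c` is positive). -/
def IsBigO (A : MaxPlusAutomaton Q S) (B : MaxPlusAutomaton P S) : Prop :=
  ∃ c : ℕ, 0 < c ∧ ∀ w : List S, A.weight w ≤ (c : NMax) * B.weight w + (c : NMax)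

end MaxPlusAutomaton

/-- An input of the big-O problem: two max-plus automata over a common finite alphabet. -/
structure BigOInstance where
  /-- the number of letters -/
  s : ℕ
  /-- the number of states of the first automaton -/
  m : ℕ
  /-- the number of states of the second automaton -/
  n : ℕ
  /-- the first automaton -/
  A : MaxPlusAutomaton (Fin m) (Fin s)
  /-- the second automaton -/
  B : MaxPlusAutomaton (Fin n) (Fin s)

/-- The symbols used to write down instances. -/
inductive Token where
  /-- a binary digit -/
  | bit (b : Bool)
  /-- the weight `-∞` -/
  | negInf
  /-- the unary digit, used for the numbers of letters and of states -/
  | tick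
  /-- the separator -/
  | sep
  deriving DecidableEq, Fintype

/-- A weight is written in binary, least significant digit first, and closed by a separator. -/
def encodeWeight (x : NMax) : List Token :=
  (WithBot.recBotCoe [Token.negInf] (fun k : ℕ => k.bits.map Token.bit) x : List Token)
    ++ [Token.sep]

/-- An automaton is written as the list of the entries of `I`, of `F`, and of the matrices `M(a)`,
row by row. -/
def encodeAutomaton {n s : ℕ} (A : MaxPlusAutomaton (Fin n) (Fin s)) : List Token :=
  ((List.finRange n).flatMap fun p => encodeWeight (A.I p)) ++
  ((List.finRange n).flatMap fun p => encodeWeight (A.F p)) ++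
  ((List.finRange s).flatMap fun a => (List.finRange n).flatMap fun p =>
    (List.finRange n).flatMap fun q => encodeWeight (A.M a p q))

/-- An instance is written as the three cardinalities in unary, followed by the two automata. -/
def encodeInstance (x : BigOInstance) : List Token :=
  List.replicate x.s Token.tick ++ [Token.sep] ++
  List.replicate x.m Token.tick ++ [Token.sep] ++
  List.replicate x.n Token.tick ++ [Token.sep] ++
  encodeAutomaton x.A ++ encodeAutomaton x.B

/-- The number of symbols that a configuration of a multi-stack machine stores. -/
def spaceUsed (tm : Turing.FinTM2) (c : tm.Cfg) : ℕ :=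
  letI := tm.kFin
  ∑ k : tm.K, (c.stk k).length

/-- The decision problem with set of inputs `inputs` and set of yes-inputs `yes`, whose inputs are
written as words by `enc`, is decidable in PSPACE: there are a deterministic Turing machine
(multi-stack, with finitely many control states and finite stack alphabets), a set of accepting
internal states and a polynomial `p` such that the machine, started on the word of any input `x`,
never stores more than `p(|enc x|)` symbols, halts, and accepts if and only if `x` is a
yes-input. -/
def DecidableInPSPACE {X T : Type} (enc : X → List T) (inputs yes : Set X) : Prop :=
  ∃ (tm : Turing.FinTM2) (_ : ∀ k, Finite (tm.Γ k)) (inp : T ↪ tm.Γ tm.k₀) (acc : Set tm.σ)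
    (p : Polynomial ℕ), ∀ x ∈ inputs,
      (∀ c, StateTransition.Reaches tm.step (Turing.initList tm ((enc x).map inp)) c →
        spaceUsed tm c ≤ p.eval (enc x).length) ∧
      ∃ c, StateTransition.Reaches tm.step (Turing.initList tm ((enc x).map inp)) c ∧
        c.l = none ∧ (c.var ∈ acc ↔ x ∈ yes)

/-- The instances `(A, B)` such that `A` is big-O of `B`. -/
def bigOYes : Set BigOInstance := {x | x.A.IsBigO x.B}

/-- The inputs of the simplified big-O problem: the pairs `(A, B)` of trim automata such that `A` is
deterministic and `⟦B⟧` does not take the value `-∞`. -/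
def simplifiedInputs : Set BigOInstance :=
  {x | x.A.IsTrim ∧ x.B.IsTrim ∧ x.A.IsDeterministic ∧ ∀ w, x.B.weight w ≠ ⊥}

/-- The big-O problem (for arbitrary pairs of automata, trim or not) is decidable in PSPACE. -/
def BigOProblemInPSPACE : Prop :=
  DecidableInPSPACE encodeInstance Set.univ bigOYes

/-- The simplified big-O problem is decidable in PSPACE. -/
def SimplifiedBigOProblemInPSPACE : Prop :=
  DecidableInPSPACE encodeInstance simplifiedInputs bigOYes

/-! An arbitrary pair (A, B) is turned into a simplified pair (A', B') with the same answer. The new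
letters are pairs (mark, target state), where a mark is an old letter or one of `startMark`,
`stopMark`, `jumpMark`. To A a hub is added, the only initial and final state of A': a start mark
leaves the hub with an initial weight of A, a stop mark returns to it with weight 2f + 1, where f is
a final weight, and a jump joins any two states with weight 0. The target component makes A'
deterministic, and jumps make it trim. B' reads only the marks. It has a similar hub, with loops on
all marks so that it may ignore a block and takes a finite value on every word, and two counting
states that yield the length of every word containing a jump; the value of A' is linear in that
length, so such words are harmless.

On a word without jumps, A' can only read a concatenation of blocks `startMark` w `stopMark`. A run
of A or B on w with weight l becomes a passage of weight between l + 1 and 2l + 1. If A is big-O of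
B with constant c, the guaranteed 1 per block in B' pays for the additive c of each block, so the
number of blocks does not matter. Conversely, if A' is big-O of B' with constant c, the block of w
is repeated c + 1 times: the additive c is then too small to hide a word that B rejects, and
division by c + 1 gives a bound for w itself. This is `determinized_isBigO_iff`.

The complexity half writes the new instance, of polynomial length, into a register and then runs the
given machine on it (`DecidableInPSPACE.of_reduction`). Register programs are compiled to
multi-stack machines (`Runs.reachesWithin`), and the predicate `Emits` is closed under
concatenation, comparison and loops (`append`, `ite_length_le`, `flatMap_symbols`). Since entries
are found by counting separators and 2k + 1 only prepends a bit, these closure properties suffice to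
show that the encoding of the new instance is emitted (`emits_encode_simplify`). -/

/-! ### Register programs and their compilation to multi-stack machines. -/

/-- Structured programs acting on registers that hold lists of tokens. -/
inductive StackProgram where
  /-- do nothing -/
  | skip
  /-- push a symbol on a register -/
  | push (r : ℕ) (c : Token)
  /-- sequential composition -/
  | seq (P Q : StackProgram)
  /-- pop the head of a register, if there is one, and continue accordingly -/
  | pop (r : ℕ) (P : Option Token → StackProgram)
  /-- as long as the register is nonempty, pop its head and run the corresponding body -/
  | loop (r : ℕ) (P : Token → StackProgram)

namespace StackProgram

/-- `Runs L P s s'`: started on the store `s`, the program `P` ends in the store `s'`, and no push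
lets a register grow beyond length `L`. -/
inductive Runs (L : ℕ) : StackProgram → (ℕ → List Token) → (ℕ → List Token) → Prop where
  | skip (s) : Runs L skip s s
  | push (s : ℕ → List Token) (r c) (h : (s r).length < L) :
      Runs L (push r c) s (Function.update s r (c :: s r))
  | seq {P Q s s' s''} (hP : Runs L P s s') (hQ : Runs L Q s' s'') : Runs L (seq P Q) s s''
  | pop {r P} {s s' : ℕ → List Token}
      (h : Runs L (P (s r).head?) (Function.update s r (s r).tail) s') : Runs L (pop r P) s s'
  | loop_nil {r P} {s : ℕ → List Token} (h : s r = []) : Runs L (loop r P) s s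
  | loop_cons {r P c l} {s s' s'' : ℕ → List Token} (h : s r = c :: l)
      (hP : Runs L (P c) (Function.update s r l) s') (hl : Runs L (loop r P) s' s'') :
      Runs L (loop r P) s s''

theorem length_update_le {L : ℕ} {s : ℕ → List Token} (h : ∀ i, (s i).length ≤ L) {r : ℕ}
    {l : List Token} (hl : l.length ≤ L) (i : ℕ) : (Function.update s r l i).length ≤ L := by
  by_cases hi : i = r
  · subst hi; simpa using hl
  · simpa [hi] using h i

theorem Runs.length_le {L : ℕ} {P : StackProgram} {s s' : ℕ → List Token} (h : Runs L P s s') :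
    (∀ i, (s i).length ≤ L) → ∀ i, (s' i).length ≤ L := by
  induction h with
  | skip => exact id
  | push s r c h => exact fun hs => length_update_le hs h
  | seq _ _ ihP ihQ => exact fun hs => ihQ (ihP hs)
  | @pop r _ s _ _ ih =>
    exact fun hs => ih (length_update_le hs (by simpa using (hs r).trans' (Nat.sub_le _ _)))
  | loop_nil => exact id
  | @loop_cons r _ c l s _ _ h _ _ ihP ihl =>
    refine fun hs => ihl (ihP (length_update_le hs ?_))
    have := hs r
    rw [h] at this
    exact (Nat.le_succ _).trans this

/-- A strict bound for the registers that a program uses. -/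
def width : StackProgram → ℕ
  | skip => 0
  | push r _ => r + 1
  | seq P Q => max P.width Q.width
  | pop r P => max (r + 1) (Finset.univ.sup fun o => (P o).width)
  | loop r P => max (r + 1) (Finset.univ.sup fun c => (P c).width)

/-- The labels of the compiled program. -/
def Label : StackProgram → Type
  | skip => Empty
  | push _ _ => Empty
  | seq P Q => P.Label ⊕ Q.Label
  | pop _ P => (o : Option Token) × Option (P o).Label
  | loop _ P => Bool ⊕ (c : Token) × Option (P c).Label

instance finite_label : ∀ P : StackProgram, Finite P.Label
  | skip => inferInstanceAs (Finite Empty)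
  | push _ _ => inferInstanceAs (Finite Empty)
  | seq P Q => by
    have := finite_label P
    have := finite_label Q
    exact inferInstanceAs (Finite (P.Label ⊕ Q.Label))
  | pop _ P => by
    have := fun o => finite_label (P o)
    exact inferInstanceAs (Finite ((o : Option Token) × Option (P o).Label))
  | loop _ P => by
    have := fun c => finite_label (P c)
    exact inferInstanceAs (Finite (Bool ⊕ (c : Token) × Option (P c).Label))

section Compile

open Turing Turing.TM2

variable {N : ℕ} [NeZero N] {K : Type} [DecidableEq K] {Γ : K → Type} {Λ σ : Type}

/-- The alphabets of `N` registers in front of a family of stacks. -/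
abbrev Alphabet (N : ℕ) (Γ : K → Type) : Fin N ⊕ K → Type
  | .inl _ => Token
  | .inr k => Γ k

/-- The stack that implements a register. -/
abbrev reg (N : ℕ) [NeZero N] (K : Type) (r : ℕ) : Fin N ⊕ K := Sum.inl (Fin.ofNat N r)

/-- The statement that starts the compiled program, with the continuation `k`. -/
def entry : (P : StackProgram) → (P.Label → Λ) → Stmt (Alphabet N Γ) Λ (σ × Option Token) →
    Stmt (Alphabet N Γ) Λ (σ × Option Token)
  | skip, _, k => k
  | push r c, _, k => .push (reg N K r) (fun _ => c) k
  | seq P Q, e, k => entry P (fun l => e (.inl l)) (entry Q (fun l => e (.inr l)) k)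
  | pop r _, e, _ => .pop (reg N K r) (fun v o => (v.1, o)) (.goto fun v => e ⟨v.2, none⟩)
  | loop _ _, e, _ => .goto fun _ => e (.inl false)

/-- The statements of the compiled program, with the continuation `k`. -/
def code : (P : StackProgram) → (P.Label → Λ) → Stmt (Alphabet N Γ) Λ (σ × Option Token) →
    P.Label → Stmt (Alphabet N Γ) Λ (σ × Option Token)
  | skip, _, k, _ => k
  | push _ _, _, k, _ => k
  | seq P Q, e, k, .inl l => code P (fun l => e (.inl l)) (entry Q (fun l => e (.inr l)) k) l
  | seq _ Q, e, k, .inr l => code Q (fun l => e (.inr l)) k l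
  | pop _ P, e, k, ⟨o, none⟩ => entry (P o) (fun l => e ⟨o, some l⟩) k
  | pop _ P, e, k, ⟨o, some l⟩ => code (P o) (fun l => e ⟨o, some l⟩) k l
  | loop r _, e, _, .inl false =>
    .pop (reg N K r) (fun v o => (v.1, o)) (.goto fun v => match v.2 with
      | none => e (.inl true)
      | some c => e (.inr ⟨c, none⟩))
  | loop _ _, _, k, .inl true => k
  | loop _ P, e, _, .inr ⟨c, none⟩ =>
    entry (P c) (fun l => e (.inr ⟨c, some l⟩)) (.goto fun _ => e (.inl false))
  | loop _ P, e, _, .inr ⟨c, some l⟩ =>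
    code (P c) (fun l => e (.inr ⟨c, some l⟩)) (.goto fun _ => e (.inl false)) l

/-- The stacks made up of the first `N` registers of a store and of further stacks. -/
def joinStacks (N : ℕ) (s : ℕ → List Token) (t : ∀ k, List (Γ k)) : ∀ k, List (Alphabet N Γ k)
  | .inl i => s i
  | .inr k => t k

omit [DecidableEq K] in
theorem joinStacks_reg {s : ℕ → List Token} {t : ∀ k, List (Γ k)} {r : ℕ} (hr : r < N) :
    joinStacks N s t (reg N K r) = s r := by
  simp [joinStacks, Nat.mod_eq_of_lt hr]

theorem update_joinStacks_reg {s : ℕ → List Token} {t : ∀ k, List (Γ k)} {r : ℕ} (hr : r < N)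
    (l : List Token) :
    Function.update (joinStacks N s t) (reg N K r) l = joinStacks N (Function.update s r l) t := by
  funext k
  rcases k with i | k
  · by_cases hi : i = Fin.ofNat N r
    · subst hi
      have : joinStacks N (Function.update s r l) t (reg N K r) = l := by
        rw [joinStacks_reg hr]; simp
      rw [Function.update_self]; exact this.symm
    · have h1 : (Sum.inl i : Fin N ⊕ K) ≠ reg N K r := by simpa [reg] using hi
      have h2 : (i : ℕ) ≠ r := by
        rintro rfl; exact hi (by simp)
      rw [Function.update_of_ne h1]
      simp [joinStacks, h2]
  · rw [Function.update_of_ne (by simp [reg])]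
    rfl

omit [NeZero N] in
theorem update_joinStacks_inr {s : ℕ → List Token} {t : ∀ k, List (Γ k)} (k : K) (l : List (Γ k)) :
    Function.update (joinStacks N s t) (Sum.inr k) l = joinStacks N s (Function.update t k l) := by
  funext j
  rcases j with i | j
  · rw [Function.update_of_ne (by simp)]; rfl
  · by_cases hj : j = k
    · subst hj
      have : joinStacks N s (Function.update t j l) (Sum.inr j) = l := by simp [joinStacks]
      rw [Function.update_self]; exact this.symm
    · rw [Function.update_of_ne (by simpa using hj)]
      simp [joinStacks, hj]

/-- Reachability through configurations with a given property (the last one excepted). -/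
def ReachesWithin {C : Type} (f : C → Option C) (good : C → Prop) : C → C → Prop :=
  Relation.ReflTransGen fun a b => good a ∧ b ∈ f a

theorem ReachesWithin.reaches {C : Type} {f : C → Option C} {good : C → Prop} {a b : C}
    (h : ReachesWithin f good a b) : StateTransition.Reaches f a b :=
  Relation.ReflTransGen.mono (fun _ _ h => h.2) _ _ h

/-- The step function is deterministic, so a reachable configuration lies either on the known path
or beyond its end. This turns a space bound along one path into a bound for all reachable
configurations. -/
theorem ReachesWithin.good_or_reaches {C : Type} {f : C → Option C} {good : C → Prop} {a b c : C}
    (h : ReachesWithin f good a b) (hc : StateTransition.Reaches f a c) :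
    good c ∨ StateTransition.Reaches f b c := by
  induction h using Relation.ReflTransGen.head_induction_on with
  | refl => exact .inr hc
  | head h _ ih =>
    rcases Relation.ReflTransGen.cases_head hc with rfl | ⟨d, hd, hdc⟩
    · exact .inl h.1
    · cases Option.mem_unique h.2 hd
      exact ih hdc

theorem stepAux_pop_goto {s : ℕ → List Token} {t : ∀ k, List (Γ k)} {r : ℕ} (hr : r < N)
    (g : σ × Option Token → Λ) (x : σ) (o : Option Token) :
    stepAux (.pop (reg N K r) (fun v o => (v.1, o)) (.goto g)) (x, o) (joinStacks N s t) =
      ⟨some (g (x, (s r).head?)), (x, (s r).head?),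
        joinStacks N (Function.update s r (s r).tail) t⟩ := by
  simp only [stepAux]
  rw [joinStacks_reg hr, update_joinStacks_reg hr]

/-- Correctness of the compiler, by induction on the run. A machine step executes a whole statement,
so configurations are visible only at jumps to labels; there all registers have length at most `L`.
The width condition keeps register numbers from wrapping modulo `N`. The second state component
holds the last popped symbol, hence its arbitrary value on exit. -/
theorem Runs.reachesWithin {L : ℕ} {t : ∀ k, List (Γ k)}
    {m : Λ → Stmt (Alphabet N Γ) Λ (σ × Option Token)}
    {good : Cfg (Alphabet N Γ) Λ (σ × Option Token) → Prop}
    (hgood : ∀ l v s, (∀ i, (s i).length ≤ L) → good ⟨l, v, joinStacks N s t⟩)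
    {P : StackProgram} {s s' : ℕ → List Token} (h : Runs L P s s') :
    ∀ (e : P.Label → Λ) (k : Stmt (Alphabet N Γ) Λ (σ × Option Token)), P.width ≤ N →
      (∀ i, (s i).length ≤ L) → (∀ l, m (e l) = code P e k l) → ∀ x o, ∃ o',
      ReachesWithin (step m) good (stepAux (entry P e k) (x, o) (joinStacks N s t))
        (stepAux k (x, o') (joinStacks N s' t)) := by
  induction h with
  | skip s => exact fun e k _ _ _ x o => ⟨o, .refl⟩
  | push s r c h =>
    intro e k hN _ _ x o
    refine ⟨o, ?_⟩
    simp only [width] at hN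
    simp only [entry, stepAux]
    rw [update_joinStacks_reg hN, joinStacks_reg hN]
    exact .refl
  | @seq P Q s s' s'' hP hQ ihP ihQ =>
    intro e k hN hs hm x o
    simp only [width, max_le_iff] at hN
    obtain ⟨o', h1⟩ := ihP (fun l => e (.inl l)) (entry Q (fun l => e (.inr l)) k) hN.1 hs
      (fun l => hm (.inl l)) x o
    obtain ⟨o'', h2⟩ := ihQ (fun l => e (.inr l)) k hN.2 (hP.length_le hs)
      (fun l => hm (.inr l)) x o'
    exact ⟨o'', h1.trans h2⟩
  | @pop r P s s' h ih =>
    intro e k hN hs hm x o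
    simp only [width, max_le_iff, Nat.succ_le_iff, Finset.sup_le_iff] at hN
    have hs' : ∀ i, (Function.update s r (s r).tail i).length ≤ L :=
      length_update_le hs (by simpa using (hs r).trans' (Nat.sub_le _ _))
    obtain ⟨o', h1⟩ := ih (fun l => e ⟨_, some l⟩) k (hN.2 _ (Finset.mem_univ _)) hs'
      (fun l => hm ⟨_, some l⟩) x (s r).head?
    refine ⟨o', Relation.ReflTransGen.head ⟨?_, ?_⟩ h1⟩
    · simp only [entry, stepAux]
      rw [joinStacks_reg hN.1, update_joinStacks_reg hN.1]
      exact hgood _ _ _ hs'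
    · simp only [entry, stepAux]
      rw [joinStacks_reg hN.1, update_joinStacks_reg hN.1]
      exact congrArg some (congrArg (fun q => stepAux q _ _) (hm ⟨_, none⟩))
  | @loop_nil r P s h =>
    intro e k hN hs hm x o
    simp only [width, max_le_iff, Nat.succ_le_iff] at hN
    have hu : Function.update s r [] = s := by rw [← h]; simp
    -- Leaving a loop takes two steps: the failed pop at the loop head, then the exit label, where
    -- the continuation is placed.
    refine ⟨none, Relation.ReflTransGen.head
      (b := ⟨some (e (.inl true)), (x, none), joinStacks N s t⟩) ⟨hgood _ _ _ hs, ?_⟩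
      (Relation.ReflTransGen.single ⟨hgood _ _ _ hs, ?_⟩)⟩
    · refine congrArg some ((congrArg (fun q => stepAux q _ _) (hm (.inl false))).trans ?_)
      refine (stepAux_pop_goto hN.1 _ _ _).trans ?_
      simp only [h, List.head?_nil, List.tail_nil, hu]
    · exact congrArg some (congrArg (fun q => stepAux q _ _) (hm (.inl true)))
  | @loop_cons r P c l s s' s'' h hP hl ihP ihl =>
    intro e k hN hs hm x o
    have hN' := hN
    simp only [width, max_le_iff, Nat.succ_le_iff, Finset.sup_le_iff] at hN
    have hs' : ∀ i, (Function.update s r l i).length ≤ L := by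
      refine length_update_le hs ?_
      have := hs r
      rw [h] at this
      exact (Nat.le_succ _).trans this
    obtain ⟨o', h1⟩ := ihP (fun l => e (.inr ⟨c, some l⟩)) (.goto fun _ => e (.inl false))
      (hN.2 _ (Finset.mem_univ _)) hs' (fun l => hm (.inr ⟨c, some l⟩)) x (some c)
    obtain ⟨o'', h2⟩ := ihl e k hN' (hP.length_le hs') hm x o'
    refine ⟨o'', Relation.ReflTransGen.head
      (b := ⟨some (e (.inr ⟨c, none⟩)), (x, some c), joinStacks N (Function.update s r l) t⟩)
      ⟨hgood _ _ _ hs, ?_⟩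
      (Relation.ReflTransGen.head ⟨hgood _ _ _ hs', ?_⟩ (h1.trans h2))⟩
    · refine congrArg some ((congrArg (fun q => stepAux q _ _) (hm (.inl false))).trans ?_)
      refine (stepAux_pop_goto hN.1 _ _ _).trans ?_
      simp only [h, List.head?_cons, List.tail_cons]
    · exact congrArg some (congrArg (fun q => stepAux q _ _) (hm (.inr ⟨c, none⟩)))

end Compile

end StackProgram

/-! ### Running a program before a given machine, and reductions in polynomial space. -/

section Composition

open Turing Turing.TM2

namespace StackProgram

variable {N : ℕ} [NeZero N] {K : Type} [DecidableEq K] {Γ : K → Type} {Λ Λ' σ : Type}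

/-- A statement of a machine, acting on the stacks behind `N` registers. -/
def liftStmt (N : ℕ) (g : Λ → Λ') : Stmt Γ Λ σ → Stmt (Alphabet N Γ) Λ' (σ × Option Token)
  | .push k f q => .push (.inr k) (fun v => f v.1) (liftStmt N g q)
  | .peek k f q => .peek (.inr k) (fun v x => (f v.1 x, v.2)) (liftStmt N g q)
  | .pop k f q => .pop (.inr k) (fun v x => (f v.1 x, v.2)) (liftStmt N g q)
  | .load f q => .load (fun v => (f v.1, v.2)) (liftStmt N g q)
  | .branch f q q' => .branch (fun v => f v.1) (liftStmt N g q) (liftStmt N g q')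
  | .goto f => .goto fun v => g (f v.1)
  | .halt => .halt

/-- A configuration of a machine, put behind `N` registers. -/
def liftCfg (N : ℕ) (g : Λ → Λ') (s : ℕ → List Token) (o : Option Token) (c : Cfg Γ Λ σ) :
    Cfg (Alphabet N Γ) Λ' (σ × Option Token) :=
  ⟨c.l.map g, (c.var, o), joinStacks N s c.stk⟩

omit [NeZero N] in
theorem stepAux_liftStmt (g : Λ → Λ') (s : ℕ → List Token) (o : Option Token) (q : Stmt Γ Λ σ)
    (v : σ) (t : ∀ k, List (Γ k)) :
    stepAux (liftStmt N g q) (v, o) (joinStacks N s t) = liftCfg N g s o (stepAux q v t) := by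
  induction q generalizing v t with
  | push k f q ih =>
    simp only [liftStmt, stepAux]
    rw [update_joinStacks_inr]; exact ih _ _
  | peek k f q ih => exact ih _ _
  | pop k f q ih =>
    simp only [liftStmt, stepAux]
    rw [update_joinStacks_inr]; exact ih _ _
  | load f q ih => exact ih _ _
  | branch f q q' ih ih' =>
    simp only [liftStmt, stepAux]
    cases f v
    · exact ih' _ _
    · exact ih _ _
  | goto f => rfl
  | halt => rfl

omit [NeZero N] in
theorem step_liftCfg {g : Λ → Λ'} {m : Λ → Stmt Γ Λ σ}
    {m' : Λ' → Stmt (Alphabet N Γ) Λ' (σ × Option Token)} (hm : ∀ l, m' (g l) = liftStmt N g (m l))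
    (s : ℕ → List Token) (o : Option Token) (c : Cfg Γ Λ σ) :
    step m' (liftCfg N g s o c) = (step m c).map (liftCfg N g s o) := by
  obtain ⟨_ | l, v, t⟩ := c
  · rfl
  · simp only [liftCfg, Option.map_some, step, hm, stepAux_liftStmt]

omit [NeZero N] in
theorem reaches_liftCfg {g : Λ → Λ'} {m : Λ → Stmt Γ Λ σ}
    {m' : Λ' → Stmt (Alphabet N Γ) Λ' (σ × Option Token)} (hm : ∀ l, m' (g l) = liftStmt N g (m l))
    (s : ℕ → List Token) (o : Option Token) {c c' : Cfg Γ Λ σ}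
    (h : StateTransition.Reaches (step m) c c') :
    StateTransition.Reaches (step m') (liftCfg N g s o c) (liftCfg N g s o c') := by
  refine Relation.ReflTransGen.lift _ (fun a b hab => ?_) _ _ h
  exact (step_liftCfg hm s o a).trans (congrArg (Option.map (liftCfg N g s o)) hab)

-- The lifted machine visits nothing but lifted configurations, so the space bound of the original
-- machine carries over to its phase of the composition.
omit [NeZero N] in
theorem exists_of_reaches_liftCfg {g : Λ → Λ'} {m : Λ → Stmt Γ Λ σ}
    {m' : Λ' → Stmt (Alphabet N Γ) Λ' (σ × Option Token)} (hm : ∀ l, m' (g l) = liftStmt N g (m l))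
    (s : ℕ → List Token) (o : Option Token) {c : Cfg Γ Λ σ}
    {d : Cfg (Alphabet N Γ) Λ' (σ × Option Token)}
    (h : StateTransition.Reaches (step m') (liftCfg N g s o c) d) :
    ∃ c', StateTransition.Reaches (step m) c c' ∧ d = liftCfg N g s o c' := by
  induction h with
  | refl => exact ⟨c, .refl, rfl⟩
  | tail _ h ih =>
    obtain ⟨c', hc', rfl⟩ := ih
    rw [step_liftCfg hm] at h
    obtain ⟨c'', h', rfl⟩ := Option.mem_map.1 h
    exact ⟨c'', hc'.tail h', rfl⟩

/-- Moving a register onto a stack of a machine, before starting that machine. -/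
def transfer (N : ℕ) [NeZero N] (out : ℕ) {k₀ : K} (inp : Token → Γ k₀) (self next : Λ') :
    Stmt (Alphabet N Γ) Λ' (σ × Option Token) :=
  .pop (reg N K out) (fun v o => (v.1, o)) <|
    .branch (fun v => v.2.isNone) (.goto fun _ => next) <|
      .push (.inr k₀) (fun v => inp (v.2.getD .sep)) (.goto fun _ => self)

/-- Each round moves one symbol, so the two stacks together never grow. The order is reversed, which
undoes the reversal in which `Emits` leaves its output. -/
theorem reachesWithin_transfer {out : ℕ} (hout : out < N) {k₀ : K} {inp : Token → Γ k₀}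
    {self next : Λ'} {m : Λ' → Stmt (Alphabet N Γ) Λ' (σ × Option Token)}
    (hm : m self = transfer N out inp self next) {L : ℕ} {t : ∀ k, List (Γ k)}
    {s : ℕ → List Token} {good : Cfg (Alphabet N Γ) Λ' (σ × Option Token) → Prop}
    (hgood : ∀ l v w (w' : List (Γ k₀)), w.length + w'.length ≤ L →
      good ⟨l, v, joinStacks N (Function.update s out w) (Function.update t k₀ w')⟩)
    (x : σ) (w : List Token) (w' : List (Γ k₀)) (hw : w.length + w'.length ≤ L)
    (o : Option Token) :
    ReachesWithin (step m) good
      ⟨some self, (x, o), joinStacks N (Function.update s out w) (Function.update t k₀ w')⟩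
      ⟨some next, (x, none), joinStacks N (Function.update s out [])
        (Function.update t k₀ (w.reverse.map inp ++ w'))⟩ := by
  induction w generalizing w' o with
  | nil =>
    refine Relation.ReflTransGen.single ⟨hgood _ _ _ _ hw, ?_⟩
    simp only [step, hm, transfer, stepAux]
    rw [joinStacks_reg hout, update_joinStacks_reg hout]
    simp
  | cons c w ih =>
    have hw' : w.length + (inp c :: w').length ≤ L := by
      simp only [List.length_cons] at hw ⊢; omega
    refine Relation.ReflTransGen.head ⟨hgood _ _ _ _ hw, ?_⟩ (b := ⟨some self, (x, some c),
      joinStacks N (Function.update s out w) (Function.update t k₀ (inp c :: w'))⟩) ?_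
    · simp only [step, hm, transfer, stepAux]
      rw [joinStacks_reg hout, update_joinStacks_reg hout]
      simp only [Function.update_self, List.head?_cons, Option.isNone_some, cond_false,
        List.tail_cons, Function.update_idem, Option.getD_some]
      rw [update_joinStacks_inr]
      simp [joinStacks]
    · rw [List.reverse_cons, List.map_append, List.append_assoc]
      exact ih _ hw' (some c)

/-- The machine that runs a program, moves the register `out` onto the input stack of another
machine, and then runs that machine. -/
noncomputable def composedMachine (tm : FinTM2) (inp : Token → tm.Γ tm.k₀) (P : StackProgram)
    (out N : ℕ) [NeZero N] : FinTM2 :=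
  letI := tm.kFin
  letI := tm.ΛFin
  letI := tm.σFin
  letI := Fintype.ofFinite P.Label
  { K := Fin N ⊕ tm.K
    k₀ := .inl 0
    k₁ := .inr tm.k₁
    Γ := Alphabet N tm.Γ
    Λ := (Bool ⊕ P.Label) ⊕ tm.Λ
    main := .inl (.inl false)
    σ := tm.σ × Option Token
    initialState := (tm.initialState, none)
    Γk₀Fin := inferInstanceAs (Fintype Token)
    m := fun
      | .inl (.inl false) => P.entry (fun l => .inl (.inr l)) (.goto fun _ => .inl (.inl true))
      | .inl (.inl true) => transfer N out inp (.inl (.inl true)) (.inr tm.main)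
      | .inl (.inr l) => P.code (fun l => .inl (.inr l)) (.goto fun _ => .inl (.inl true)) l
      | .inr l => liftStmt N .inr (tm.m l) }

end StackProgram

/-- `f` can be computed in polynomial space from the functions `Γ v`: for every placement of the
values `Γ v a` in registers below `d`, some program appends `f a` to the register `out`, last symbol
on top, and leaves the other registers as they were. It uses the registers from `d` on as scratch
space. -/
def Emits {V α : Type} (Γ : V → α → List Token) (f : α → List Token) : Prop :=
  ∃ p : Polynomial ℕ, (∀ a n, (∀ v, (Γ v a).length ≤ n) → (f a).length ≤ p.eval n) ∧
    ∀ (loc : V → ℕ) (d out : ℕ), (∀ v, loc v < d) → out < d → (∀ v, loc v ≠ out) →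
      ∃ P : StackProgram, ∀ a n L (s : ℕ → List Token), (∀ v, (Γ v a).length ≤ n) →
        (∀ v, s (loc v) = Γ v a) → (∀ r, d ≤ r → s r = []) → p.eval n ≤ L →
        (s out).length + (f a).length ≤ L →
        P.Runs L s (Function.update s out ((f a).reverse ++ s out))

theorem Polynomial.eval_mono_nat (p : Polynomial ℕ) {m n : ℕ} (h : m ≤ n) :
    p.eval m ≤ p.eval n := by
  rw [Polynomial.eval_eq_sum, Polynomial.eval_eq_sum]
  exact Finset.sum_le_sum fun i _ => Nat.mul_le_mul_left _ (Nat.pow_le_pow_left h i)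

theorem initList_eq (tm : FinTM2) (w : List (tm.Γ tm.k₀)) :
    initList tm w = ⟨some tm.main, tm.initialState, Function.update (fun _ => []) tm.k₀ w⟩ := by
  simp only [initList]
  congr 1
  funext k
  by_cases hk : k = tm.k₀
  · subst hk
    simp
  · simp [hk]

open StackProgram in
/-- Decidability in polynomial space is inherited along reductions in polynomial space. -/
theorem DecidableInPSPACE.of_reduction {X Y : Type} {enc : X → List Token} {inputs yes : Set X}
    {enc' : Y → List Token} {inputs' yes' : Set Y} (h : DecidableInPSPACE enc inputs yes)
    {f : Y → X} (hf : Emits (fun (_ : Unit) => enc') (fun y => enc (f y)))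
    (hmaps : ∀ y ∈ inputs', f y ∈ inputs) (hyes : ∀ y ∈ inputs', (f y ∈ yes ↔ y ∈ yes')) :
    DecidableInPSPACE enc' inputs' yes' := by
  obtain ⟨tm, hΓ, inp, acc, p, hp⟩ := h
  obtain ⟨q, hq, hP⟩ := hf
  -- The input is in register 0, the output goes to register 1, and scratch space begins at register
  -- 2.
  obtain ⟨P, hP⟩ := hP (fun _ => 0) 2 1 (by simp) (by simp) (by simp)
  let N := max P.width 2
  have hPN : P.width ≤ N := le_max_left _ _
  have h1N : 1 < N := lt_of_lt_of_le one_lt_two (le_max_right _ _)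
  have : NeZero N := ⟨by omega⟩
  -- This bounds every register: `q` covers the scratch space and the output, `X` the input. In the
  -- total below, `N * B` pays for the registers, `B` for the input stack while it is filled, and
  -- `p.comp B` for the second machine.
  let B : Polynomial ℕ := q + Polynomial.X
  let _ := tm.kFin
  refine ⟨composedMachine tm inp P 1 N, ?_, Function.Embedding.refl Token, {v | v.1 ∈ acc},
    (N : Polynomial ℕ) * B + B + p.comp B, fun y hy => ?_⟩
  · rintro (i | k)
    · exact inferInstanceAs (Finite Token)
    · exact hΓ k
  obtain ⟨hspace, c, hc, hcl, hcacc⟩ := hp (f y) (hmaps y hy)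
  set n := (enc' y).length with hn
  set L := B.eval n with hL
  have hLeq : L = q.eval n + n := by simp [hL, B]
  have hout : (enc (f y)).length ≤ q.eval n := hq y n fun _ => le_rfl
  have hused : ∀ (s : ℕ → List Token) (l v) (t : ∀ k, List (tm.Γ k)),
      spaceUsed (composedMachine tm inp P 1 N) ⟨l, v, joinStacks N s t⟩ =
        ∑ i : Fin N, (s i).length + ∑ k, (t k).length := by
    intro s l v t
    exact Fintype.sum_sum_type _
  have hsum : ∀ s : ℕ → List Token, (∀ i, (s i).length ≤ L) →
      ∑ i : Fin N, (s i).length ≤ N * L := by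
    intro s hs
    refine (Finset.sum_le_card_nsmul Finset.univ (fun i : Fin N => (s i).length) L
      fun i _ => hs i).trans ?_
    simp
  let t₀ : ∀ k, List (tm.Γ k) := fun _ => []
  have hsum' : ∀ w : List (tm.Γ tm.k₀),
      ∑ k, (Function.update t₀ tm.k₀ w k).length = w.length := by
    intro w
    rw [Finset.sum_eq_single tm.k₀]
    · simp
    · intro k _ hk
      simp [hk, t₀]
    · simp
  let M := (composedMachine tm inp P 1 N).m
  let good : (composedMachine tm inp P 1 N).Cfg → Prop :=
    fun c => spaceUsed _ c ≤ N * L + L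
  let s₀ : ℕ → List Token := Function.update (fun _ => []) 0 (enc' y)
  have hs₀ : ∀ i, (s₀ i).length ≤ L := length_update_le (by simp) (by omega)
  let s₁ : ℕ → List Token := Function.update s₀ 1 []
  have hs₁ : ∀ i, (s₁ i).length ≤ L := length_update_le hs₀ (by simp)
  have hinit : initList (composedMachine tm inp P 1 N)
      ((enc' y).map (Function.Embedding.refl Token)) =
      ⟨some (.inl (.inl false)), (tm.initialState, none), joinStacks N s₀ t₀⟩ := by
    rw [initList_eq]
    refine congrArg _ ?_
    refine Eq.trans ?_ (update_joinStacks_reg (s := fun _ => []) (t := t₀) (by omega) (enc' y))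
    congr 1
    · funext k
      rcases k with i | k <;> rfl
    · exact List.map_id _
  have hreach : ReachesWithin (composedMachine tm inp P 1 N).step good
      (initList (composedMachine tm inp P 1 N) ((enc' y).map (Function.Embedding.refl Token)))
      (liftCfg N .inr s₁ none (initList tm ((enc (f y)).map inp))) := by
    have hrun := hP y n L s₀ (fun _ => le_rfl) (by simp [s₀])
      (fun r hr => by simp [s₀, show r ≠ 0 by omega]) (by omega) (by simp [s₀]; omega)
    have hgood₁ : ∀ l v s, (∀ i, (s i).length ≤ L) → good ⟨l, v, joinStacks N s t₀⟩ := by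
      intro l v s hs
      have h0 : ∑ k, (t₀ k).length = 0 := by simp [t₀]
      refine (hused s l v t₀).le.trans ?_
      rw [h0]
      exact (hsum s hs).trans (Nat.le_add_right _ _)
    obtain ⟨o, h1⟩ := hrun.reachesWithin hgood₁ (fun l => .inl (.inr l))
      (.goto fun _ => .inl (.inl true)) hPN hs₀ (m := M) (fun l => rfl) tm.initialState none
    have h2 := reachesWithin_transfer (t := t₀) (s := s₀) (good := good) (L := L) h1N
      (inp := inp) (m := M) (self := .inl (.inl true)) (next := .inr tm.main) rfl
      (by
        intro l v w w' hw
        refine (hused (Function.update s₀ 1 w) l v (Function.update t₀ tm.k₀ w')).le.trans ?_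
        rw [hsum']
        exact add_le_add (hsum _ (length_update_le hs₀ (by omega))) (by omega)) tm.initialState (enc (f y)).reverse [] (by simp; omega) o
    rw [hinit, initList_eq]
    refine Relation.ReflTransGen.head ⟨hgood₁ _ _ _ hs₀, rfl⟩ (h1.trans ?_)
    have ht₀ : Function.update t₀ tm.k₀ [] = t₀ := by simp [t₀]
    simp only [List.reverse_reverse, List.append_nil, ht₀] at h2
    have hs : Function.update s₀ 1 ((enc (f y)).reverse ++ s₀ 1) =
        Function.update s₀ 1 (enc (f y)).reverse := by simp [s₀]
    rw [hs]
    exact h2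
  have hlift : ∀ l, (composedMachine tm inp P 1 N).m (.inr l) = liftStmt N .inr (tm.m l) :=
    fun _ => rfl
  constructor
  · intro d hd
    simp only [Polynomial.eval_add, Polynomial.eval_mul, Polynomial.eval_natCast,
      Polynomial.eval_comp, ← hL, Nat.cast_id]
    rcases hreach.good_or_reaches hd with hd | hd
    · exact le_add_right hd
    · obtain ⟨c', hc', rfl⟩ := exists_of_reaches_liftCfg hlift s₁ none hd
      have h1 := hused s₁ (c'.l.map .inr) (c'.var, none) c'.stk
      have h2 := hsum s₁ hs₁
      have h3 := (hspace c' hc').trans (p.eval_mono_nat (show (enc (f y)).length ≤ L by omega))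
      refine h1.le.trans ?_
      have h4 : ∑ k, (c'.stk k).length = spaceUsed tm c' := rfl
      omega
  · refine ⟨_, hreach.reaches.trans (reaches_liftCfg hlift s₁ none hc), ?_, ?_⟩
    · exact congrArg (Option.map _) hcl
    · exact hcacc.trans (hyes y hy)

end Composition

/-! ### Elementary programs and closure properties of `Emits`. -/

namespace StackProgram

variable {L : ℕ}

theorem _root_.List.reverse_take_succ {β : Type*} {w : List β} {i : ℕ} (hi : i < w.length) :
    (w.take (i + 1)).reverse = w[i] :: (w.take i).reverse := by
  rw [List.take_succ_eq_append_getElem hi, List.reverse_append]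
  rfl

/-- The loop invariant is given as an explicit sequence: `S i` is the whole store before round `i`.
-/
theorem runs_loop {r : ℕ} {P : Token → StackProgram} {w : List Token} (S : ℕ → ℕ → List Token)
    (hS : ∀ i, S i r = w.drop i)
    (hstep : ∀ i (h : i < w.length),
      Runs L (P w[i]) (Function.update (S i) r (w.drop (i + 1))) (S (i + 1))) :
    Runs L (loop r P) (S 0) (S w.length) := by
  have key : ∀ j i, i + j = w.length → Runs L (loop r P) (S i) (S w.length) := by
    intro j
    induction j with
    | zero =>
      rintro i rfl
      exact .loop_nil (by simp [hS])
    | succ j ih =>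
      intro i hi
      have hi' : i < w.length := by omega
      exact .loop_cons (by rw [hS, List.drop_eq_getElem_cons hi']) (hstep i hi')
        (ih (i + 1) (by omega))
  exact key w.length 0 (Nat.zero_add _)

/-- Empty a register. -/
def clear (r : ℕ) : StackProgram := loop r fun _ => skip

theorem runs_clear (s : ℕ → List Token) (r : ℕ) :
    Runs L (clear r) s (Function.update s r []) := by
  have := runs_loop (L := L) (r := r) (P := fun _ => skip) (w := s r)
    (fun i => Function.update s r ((s r).drop i)) (by simp)
    (fun i h => by rw [Function.update_idem]; exact .skip _)
  simpa [clear] using this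

/-- Pour a register onto another one. -/
def move (r r' : ℕ) : StackProgram := loop r fun c => push r' c

theorem runs_move (s : ℕ → List Token) {r r' : ℕ} (hr : r ≠ r')
    (h : (s r).length + (s r').length ≤ L) :
    Runs L (move r r') s
      (Function.update (Function.update s r []) r' ((s r).reverse ++ s r')) := by
  have := runs_loop (L := L) (r := r) (P := fun c => push r' c) (w := s r)
    (fun i => Function.update (Function.update s r ((s r).drop i)) r'
      (((s r).take i).reverse ++ s r')) (by simp [hr])
    (fun i hi => by
      have := Runs.push (L := L) (Function.update (Function.update (Function.update s r
        ((s r).drop i)) r' (((s r).take i).reverse ++ s r')) r ((s r).drop (i + 1))) r' (s r)[i]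
        (by simp [hr.symm]; omega)
      convert this using 1
      rw [List.reverse_take_succ hi]
      funext j
      simp only [Function.update_apply]
      split_ifs <;> first | rfl | omega)
  simpa [move] using this

end StackProgram

namespace Emits

open StackProgram

variable {V α : Type} {Γ : V → α → List Token} {f g : α → List Token}

/-- Reading a register destroys it, so a second copy is made in the scratch register `d` and poured
back; two reversals restore the order. -/
theorem var (v : V) : Emits Γ (Γ v) := by
  refine ⟨.X, fun a n h => by simpa using h v, fun loc d out hloc hout hne =>
    ⟨seq (loop (loc v) fun c => seq (push out c) (push d c)) (move d (loc v)),
      fun a n L s hn hs hd hL hlen => ?_⟩⟩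
  have hv := hloc v
  have hv' := hne v
  have hw := hn v
  simp only [Polynomial.eval_X] at hL
  have h1 := runs_loop (L := L) (r := loc v) (P := fun c => seq (push out c) (push d c))
    (w := Γ v a) (fun i => Function.update (Function.update (Function.update s (loc v)
      ((Γ v a).drop i)) out (((Γ v a).take i).reverse ++ s out)) d ((Γ v a).take i).reverse)
    (fun i => by simp [hv', hv.ne])
    (fun i hi => by
      refine .seq (.push _ _ _ ?_) ?_
      · simp [hv'.symm, hout.ne]; omega
      · convert Runs.push _ _ _ _ using 1
        · rw [List.reverse_take_succ hi]
          funext j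
          simp only [Function.update_apply]
          split_ifs <;> first | rfl | omega
        · simp [hv.ne', hout.ne']; omega)
  have h2 := runs_move (L := L) (Function.update (Function.update (Function.update s (loc v)
    []) out ((Γ v a).reverse ++ s out)) d (Γ v a).reverse) (r := d) (r' := loc v) hv.ne'
    (by simp [hv', hv.ne]; omega)
  have h0 := hd d le_rfl
  have h0' := hs v
  convert Runs.seq h1 (by simpa using h2) using 1
  · funext j
    simp only [Function.update_apply]
    split_ifs with h1 h2 h3 <;> simp [*]
  · funext j
    simp only [Function.update_apply]
    split_ifs with h1 h2 h3 <;> first | omega | simp [*]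

theorem nil : Emits Γ fun _ => [] :=
  ⟨0, by simp, fun _ _ _ _ _ _ => ⟨.skip, fun a n L s _ _ _ _ _ => by simpa using Runs.skip s⟩⟩

theorem symbol (c : Token) : Emits Γ fun _ => [c] :=
  ⟨1, by simp, fun _ _ out _ _ _ => ⟨.push out c, fun a n L s _ _ _ _ h =>
    .push s out c (by simpa using h)⟩⟩

theorem append (hf : Emits Γ f) (hg : Emits Γ g) : Emits Γ fun a => f a ++ g a := by
  obtain ⟨p, hp, hP⟩ := hf
  obtain ⟨q, hq, hQ⟩ := hg
  refine ⟨p + q, fun a n h => by simpa using add_le_add (hp a n h) (hq a n h),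
    fun loc d out hloc hout hne => ?_⟩
  obtain ⟨P, hP⟩ := hP loc d out hloc hout hne
  obtain ⟨Q, hQ⟩ := hQ loc d out hloc hout hne
  refine ⟨P.seq Q, fun a n L s hn hs hd hL hlen => ?_⟩
  simp only [Polynomial.eval_add, List.length_append] at hL hlen
  have h1 := hP a n L s hn hs hd (by omega) (by omega)
  have h2 := hQ a n L (Function.update s out ((f a).reverse ++ s out)) hn
    (fun v => by simpa [hne v] using hs v)
    (fun r hr => by simpa [show r ≠ out by omega] using hd r hr) (by omega) (by simp; omega)
  simpa using Runs.seq h1 h2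

theorem const (l : List Token) : Emits Γ fun _ => l := by
  induction l with
  | nil => exact nil
  | cons c l ih => exact (symbol c).append ih

/-- Both words are written to scratch registers and popped in parallel. The register `d + 2`
collects one tick for each symbol by which the first word is longer, so its emptiness decides the
test. -/
theorem ite_length_le {f' g' : α → List Token} (hg : Emits Γ g) (hg' : Emits Γ g')
    (hf : Emits Γ f) (hf' : Emits Γ f') :
    Emits Γ fun a => if (g a).length ≤ (g' a).length then f a else f' a := by
  obtain ⟨p, hp, hP⟩ := hf
  obtain ⟨p', hp', hP'⟩ := hf'
  obtain ⟨q, hq, hQ⟩ := hg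
  obtain ⟨q', hq', hQ'⟩ := hg'
  refine ⟨p + p' + q + q', fun a n h => ?_, fun loc d out hloc hout hne => ?_⟩
  · have := hp a n h
    have := hp' a n h
    simp only [Polynomial.eval_add]
    split_ifs <;> omega
  obtain ⟨P, hP⟩ := hP loc d out hloc hout hne
  obtain ⟨P', hP'⟩ := hP' loc d out hloc hout hne
  obtain ⟨Q, hQ⟩ := hQ loc (d + 3) d (fun v => (hloc v).trans (by omega)) (by omega)
    (fun v => (hloc v).ne)
  obtain ⟨Q', hQ'⟩ := hQ' loc (d + 3) (d + 1) (fun v => (hloc v).trans (by omega)) (by omega)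
    (fun v => by have := hloc v; omega)
  refine ⟨Q.seq (Q'.seq ((loop d fun _ => pop (d + 1) fun o => o.elim (push (d + 2) .tick)
    fun _ => skip).seq ((clear (d + 1)).seq (pop (d + 2) fun o => o.elim P
    fun _ => (clear (d + 2)).seq P')))), fun a n L s hn hs hd hL hlen => ?_⟩
  simp only [Polynomial.eval_add] at hL
  have hga := hq a n hn
  have hga' := hq' a n hn
  have hd0 := hd d le_rfl
  have hd1 := hd (d + 1) (by omega)
  have hd2 := hd (d + 2) (by omega)
  have h1 := hQ a n L s hn hs (fun r hr => hd r (by omega)) (by omega) (by simp [hd0]; omega)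
  have h2 := hQ' a n L (Function.update s d ((g a).reverse ++ s d)) hn
    (fun v => by simpa [(hloc v).ne] using hs v)
    (fun r hr => by simpa [show r ≠ d by omega] using hd r (by omega)) (by omega)
    (by simp [hd1]; omega)
  refine .seq h1 (.seq h2 ?_)
  have h3 := runs_loop (L := L) (r := d) (P := fun _ => pop (d + 1) fun o =>
    o.elim (push (d + 2) .tick) fun _ => skip) (w := (g a).reverse)
    (fun i => Function.update (Function.update (Function.update s d ((g a).reverse.drop i))
      (d + 1) ((g' a).reverse.drop i)) (d + 2)
      (List.replicate (i - (g' a).length) Token.tick)) (by simp)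
    (fun i hi => by
      refine .pop ?_
      simp only [List.length_reverse] at hi
      rcases lt_or_ge i (g' a).length with h | h
      · have h' : i < (g' a).reverse.length := by simpa using h
        rw [List.drop_eq_getElem_cons h']
        convert Runs.skip _ using 1
        · simp
        · rw [show i + 1 - (g' a).length = 0 by omega, show i - (g' a).length = 0 by omega]
          funext j
          simp only [Function.update_apply]
          split_ifs <;> first | rfl | omega
      · rw [List.drop_eq_nil_of_le (as := (g' a).reverse) (by simpa using h),
          List.drop_eq_nil_of_le (as := (g' a).reverse) (i := i + 1) (by simp; omega)]
        convert Runs.push _ (d + 2) .tick _ using 1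
        · simp
        · rw [show i + 1 - (g' a).length = (i - (g' a).length) + 1 by omega]
          funext j
          simp only [Function.update_apply, List.replicate_succ]
          split_ifs <;> first | rfl | omega
        · simp; omega)
  have hs2 : Function.update (Function.update s d ((g a).reverse ++ s d)) (d + 1)
      ((g' a).reverse ++ Function.update s d ((g a).reverse ++ s d) (d + 1)) =
      Function.update (Function.update (Function.update s d ((g a).reverse.drop 0))
      (d + 1) ((g' a).reverse.drop 0)) (d + 2)
      (List.replicate (0 - (g' a).length) Token.tick) := by
    funext j
    simp only [Function.update_apply]
    split_ifs <;> first | omega | simp [*]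
  rw [hs2]
  refine .seq h3 (.seq (runs_clear _ _) (.pop ?_))
  by_cases hle : (g a).length ≤ (g' a).length
  · simp only [hle, if_true] at hlen ⊢
    have h4 := hP a n L s hn hs hd (by omega) hlen
    convert h4 using 1
    · simp [hle]
    · funext j
      simp only [Function.update_apply]
      split_ifs <;> first | omega | simp [*]
  · simp only [hle, if_false] at hlen ⊢
    have h4 := hP' a n L s hn hs hd (by omega) hlen
    obtain ⟨k, hk⟩ : ∃ k, (g a).length - (g' a).length = k + 1 :=
      ⟨(g a).length - (g' a).length - 1, by omega⟩
    have h5 : Runs L ((clear (d + 2)).seq P') (Function.update s (d + 2)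
        (List.replicate k Token.tick)) (Function.update s out ((f' a).reverse ++ s out)) := by
      refine .seq (runs_clear _ _) ?_
      convert h4 using 1
      funext j
      simp only [Function.update_apply]
      split_ifs <;> simp [*]
    convert h5 using 1
    · simp [hk, List.replicate_succ]
    · funext j
      simp only [Function.update_apply]
      split_ifs <;> first | omega | simp [*, List.replicate_succ]

/-- The context inside a loop: the number of completed rounds, in unary, is made available. -/
def extend (Γ : V → α → List Token) (N : α → ℕ) : Option V → (Σ a, Fin (N a)) → List Token
  | none, x => List.replicate x.2 Token.tick
  | some v, x => Γ v x.1

/-- The only source of iteration: a word is computed first, then consumed symbol by symbol, and each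
symbol selects the program for its round. The output is bounded because the number of rounds is at
most the length of that word. -/
theorem flatMap_symbols {N : α → ℕ} {sym : ∀ a, Fin (N a) → Token}
    (hf : Emits Γ fun a => List.ofFn (sym a)) {g : Token → (Σ a, Fin (N a)) → List Token}
    (hg : ∀ c, Emits (extend Γ N) (g c)) :
    Emits Γ fun a => (List.finRange (N a)).flatMap fun i => g (sym a i) ⟨a, i⟩ := by
  obtain ⟨p, hp, hP⟩ := hf
  choose q hq hQ using hg
  have hN : ∀ a n, (∀ v, (Γ v a).length ≤ n) → N a ≤ p.eval n := by
    intro a n h; simpa using hp a n h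
  have hext : ∀ a n (i : Fin (N a)), (∀ v, (Γ v a).length ≤ n) →
      ∀ v, (extend Γ N v ⟨a, i⟩).length ≤ n + p.eval n := by
    rintro a n i h (_ | v)
    · have := hN a n h
      simp only [extend, List.length_replicate]
      omega
    · exact (h v).trans (Nat.le_add_right _ _)
  have hqsum : ∀ c n, (q c).eval n ≤ (∑ c, q c).eval n := by
    intro c n
    rw [Polynomial.eval_finsetSum]
    exact Finset.single_le_sum (f := fun c => (q c).eval n) (fun _ _ => Nat.zero_le _)
      (Finset.mem_univ c)
  -- The summands leave room for the word and the round counter, for one round in the enlarged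
  -- context (whose entries have length at most `n + p n`), and for the output of all rounds. The
  -- sum over `c` serves as a common bound for the finitely many symbols.
  refine ⟨2 * p + (∑ c, q c).comp (.X + p) + p * (∑ c, q c).comp (.X + p), fun a n h => ?_,
    fun loc d out hloc hout hne => ?_⟩
  · simp only [Polynomial.eval_add, Polynomial.eval_mul, Polynomial.eval_comp, Polynomial.eval_X]
    rw [List.length_flatMap]
    refine (List.sum_le_card_nsmul _ ((∑ c, q c).eval (n + p.eval n)) ?_).trans ?_
    · simp only [List.mem_map, forall_exists_index, and_imp]
      rintro _ i _ rfl
      exact (hq _ _ _ (hext a n i h)).trans (hqsum _ _)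
    · simp only [List.length_map, List.length_finRange, smul_eq_mul]
      exact (Nat.mul_le_mul_right _ (hN a n h)).trans (Nat.le_add_left _ _)
  obtain ⟨P, hP⟩ := hP loc (d + 2) d (fun v => (hloc v).trans (by omega)) (by omega)
    (fun v => (hloc v).ne)
  -- Register `d` becomes the location of the round counter and `d + 1` holds the unread symbols, so
  -- the bodies get their scratch space from `d + 2` on.
  choose Q hQ using fun c => hQ c (fun v => v.elim d loc) (d + 2) out
    (by rintro (_ | v)
        · simp
        · exact (hloc v).trans (by omega)) (by omega)
    (by rintro (_ | v)
        · exact hout.ne'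
        · exact hne v)
  refine ⟨P.seq ((move d (d + 1)).seq ((loop (d + 1) fun c => (Q c).seq (push d .tick)).seq
    (clear d))), fun a n L s hn hs hd hL hlen => ?_⟩
  simp only [Polynomial.eval_add, Polynomial.eval_mul, Polynomial.eval_comp, Polynomial.eval_X,
    Polynomial.eval_ofNat] at hL
  have hNa := hN a n hn
  have hd0 := hd d le_rfl
  have hd1 := hd (d + 1) (by omega)
  set w := List.ofFn (sym a) with hw
  have hwl : w.length = N a := by simp [hw]
  set F : Fin (N a) → List Token := fun i => g (sym a i) ⟨a, i⟩ with hF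
  change (s out).length + ((List.finRange (N a)).flatMap F).length ≤ L at hlen
  have h1 := hP a n L s hn hs (fun r hr => hd r (by omega)) (by omega) (by simp [hd0]; omega)
  have h2 := runs_move (L := L) (Function.update s d (w.reverse ++ s d)) (r := d) (r' := d + 1)
    (by omega) (by simp [hd0, hd1]; omega)
  refine .seq h1 (.seq h2 ?_)
  have h3 := runs_loop (L := L) (r := d + 1) (P := fun c => (Q c).seq (push d .tick)) (w := w)
    (fun i => Function.update (Function.update (Function.update s d
      (List.replicate i Token.tick)) (d + 1) (w.drop i)) out
      ((((List.finRange (N a)).take i).flatMap F).reverse ++ s out))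
    (by simp [show d + 1 ≠ out by omega])
    (fun i hi => by
      have hi' : i < N a := by omega
      have hget : w[i] = sym a ⟨i, hi'⟩ := by simp [hw]
      have htake : (List.finRange (N a)).take (i + 1) =
          (List.finRange (N a)).take i ++ [⟨i, hi'⟩] := by
        rw [List.take_succ_eq_append_getElem (by simpa using hi')]
        simp
      have hlen' : (((List.finRange (N a)).take (i + 1)).flatMap F).length ≤
          ((List.finRange (N a)).flatMap F).length :=
        ((List.take_sublist _ _).flatMap _).length_le
      rw [htake, List.flatMap_append, List.flatMap_singleton, List.length_append] at hlen'
      have h4 := hQ w[i] ⟨a, ⟨i, hi'⟩⟩ (n + p.eval n) L (Function.update (Function.update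
        (Function.update (Function.update s d (List.replicate i Token.tick)) (d + 1)
        (w.drop i)) out ((((List.finRange (N a)).take i).flatMap F).reverse ++ s out)) (d + 1)
        (w.drop (i + 1))) (hext a n _ hn)
        (by rintro (_ | v)
            · simp [extend, hout.ne']
            · have := hloc v
              simp [extend, hne v, hs v, show loc v ≠ d + 1 by omega, show loc v ≠ d by omega])
        (fun r hr => by
          simpa [show r ≠ out by omega, show r ≠ d by omega, show r ≠ d + 1 by omega] using
            hd r (by omega))
        ((hqsum _ _).trans (by omega))
        (by rw [hget, Function.update_of_ne (by omega), Function.update_self, List.length_append,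
              List.length_reverse]
            have hFi : (F ⟨i, hi'⟩).length = (g (sym a ⟨i, hi'⟩) ⟨a, ⟨i, hi'⟩⟩).length := rfl
            omega)
      refine .seq h4 ?_
      convert Runs.push _ d .tick _ using 1
      · rw [htake, List.flatMap_append, List.flatMap_singleton]
        funext j
        simp only [Function.update_apply, List.replicate_succ]
        split_ifs <;> first | omega | simp [*]
      · simp [hout.ne']; omega)
  have hs2 : Function.update (Function.update (Function.update s d (w.reverse ++ s d)) d [])
      (d + 1) ((Function.update s d (w.reverse ++ s d) d).reverse ++
        Function.update s d (w.reverse ++ s d) (d + 1)) =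
      Function.update (Function.update (Function.update s d (List.replicate 0 Token.tick)) (d + 1)
        (w.drop 0)) out ((((List.finRange (N a)).take 0).flatMap F).reverse ++ s out) := by
    funext j
    simp only [Function.update_apply]
    split_ifs <;> first | omega | simp [*]
  rw [hs2]
  refine .seq h3 ?_
  convert runs_clear _ _ using 1
  rw [hwl, List.take_of_length_le (by simp), List.drop_of_length_le (by omega)]
  funext j
  simp only [Function.update_apply]
  split_ifs <;> first | omega | simp [*]

end Emits

/-! ### Max-plus weights in terms of runs. -/

theorem NMax.eq_bot_or_coe (x : NMax) : x = ⊥ ∨ ∃ k : ℕ, x = k := by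
  induction x using WithBot.recBotCoe with
  | bot => exact .inl rfl
  | coe k => exact .inr ⟨k, rfl⟩

namespace MaxPlusAutomaton

section Runs

variable {Q P S T : Type}

/-- `A` has a run from `p` labelled `w` to a final state, of total weight `k`, the final weight
being included. -/
def HasRun (A : MaxPlusAutomaton Q S) : List S → Q → ℕ → Prop
  | [], p, k => A.F p = k
  | a :: w, p, k => ∃ r, ∃ x y : ℕ, A.M a p r = x ∧ A.HasRun w r y ∧ k = x + y

/-- `A` has a run labelled `w` from an initial to a final state, of total weight `k`. -/
def Accepts (A : MaxPlusAutomaton Q S) (w : List S) (k : ℕ) : Prop :=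
  ∃ p, ∃ i j : ℕ, A.I p = i ∧ A.HasRun w p j ∧ k = i + j

/-- The automaton that reads a word through a map of alphabets. -/
def relabel (A : MaxPlusAutomaton Q S) (π : T → S) : MaxPlusAutomaton Q T where
  M t := A.M (π t)
  I := A.I
  F := A.F

theorem hasRun_relabel (A : MaxPlusAutomaton Q S) (π : T → S) (w : List T) (p : Q) (k : ℕ) :
    (A.relabel π).HasRun w p k ↔ A.HasRun (w.map π) p k := by
  induction w generalizing p k with
  | nil => rfl
  | cons a w ih => simp only [HasRun, List.map_cons, ih]; rfl

variable [Fintype Q] [DecidableEq Q] [Fintype P] [DecidableEq P]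

theorem HasRun.exists_le {A : MaxPlusAutomaton Q S} {w : List S} {p : Q} {k : ℕ}
    (h : A.HasRun w p k) : ∃ q, (k : NMax) ≤ A.wordMatrix w p q + A.F q := by
  induction w generalizing p k with
  | nil =>
    refine ⟨p, ?_⟩
    simp only [HasRun] at h
    simp [wordMatrix, mpOne, h]
  | cons a w ih =>
    obtain ⟨r, x, y, hx, hy, rfl⟩ := h
    obtain ⟨q, hq⟩ := ih hy
    refine ⟨q, ?_⟩
    have h1 : A.M a p r + A.wordMatrix w r q ≤ A.wordMatrix (a :: w) p q :=
      Finset.le_sup (f := fun r => A.M a p r + A.wordMatrix w r q) (Finset.mem_univ r)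
    calc ((x + y : ℕ) : NMax) = A.M a p r + (y : NMax) := by rw [hx]; norm_cast
      _ ≤ A.M a p r + (A.wordMatrix w r q + A.F q) := by gcongr
      _ = (A.M a p r + A.wordMatrix w r q) + A.F q := (add_assoc _ _ _).symm
      _ ≤ _ := by gcongr

theorem hasRun_of_eq {A : MaxPlusAutomaton Q S} {w : List S} {p q : Q} {k : ℕ}
    (h : A.wordMatrix w p q + A.F q = k) : A.HasRun w p k := by
  induction w generalizing p k with
  | nil =>
    by_cases hpq : p = q
    · subst hpq
      simpa [wordMatrix, mpOne, HasRun] using h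
    · simp [wordMatrix, mpOne, hpq] at h
  | cons a w ih =>
    obtain ⟨r, -, hr⟩ := Finset.exists_mem_eq_sup Finset.univ ⟨p, Finset.mem_univ p⟩
      fun r => A.M a p r + A.wordMatrix w r q
    have h' : A.M a p r + (A.wordMatrix w r q + A.F q) = k := by
      rw [← add_assoc, ← hr]; exact h
    obtain ⟨x, y, hx, hy, hxy⟩ := WithBot.add_eq_coe.1 h'
    exact ⟨r, x, y, hx.symm, ih hy.symm, hxy.symm⟩

theorem Accepts.le_weight {A : MaxPlusAutomaton Q S} {w : List S} {k : ℕ} (h : A.Accepts w k) :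
    (k : NMax) ≤ A.weight w := by
  obtain ⟨p, i, j, hi, hj, rfl⟩ := h
  obtain ⟨q, hq⟩ := hj.exists_le
  calc ((i + j : ℕ) : NMax) = A.I p + (j : NMax) := by rw [hi]; norm_cast
    _ ≤ A.I p + (A.wordMatrix w p q + A.F q) := by gcongr
    _ = A.I p + A.wordMatrix w p q + A.F q := (add_assoc _ _ _).symm
    _ ≤ Finset.univ.sup fun q => A.I p + A.wordMatrix w p q + A.F q :=
      Finset.le_sup (f := fun q => A.I p + A.wordMatrix w p q + A.F q) (Finset.mem_univ q)
    _ ≤ _ := Finset.le_sup (f := fun p => Finset.univ.sup fun q =>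
      A.I p + A.wordMatrix w p q + A.F q) (Finset.mem_univ p)

theorem accepts_of_weight_eq {A : MaxPlusAutomaton Q S} {w : List S} {k : ℕ}
    (h : A.weight w = k) : A.Accepts w k := by
  have hne : Nonempty Q := by
    by_contra hQ
    rw [not_nonempty_iff] at hQ
    simp [weight] at h
  obtain ⟨p, -, hp⟩ := Finset.exists_mem_eq_sup Finset.univ Finset.univ_nonempty
    fun p => Finset.univ.sup fun q => A.I p + A.wordMatrix w p q + A.F q
  obtain ⟨q, -, hq⟩ := Finset.exists_mem_eq_sup Finset.univ Finset.univ_nonempty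
    fun q => A.I p + A.wordMatrix w p q + A.F q
  have h' : A.I p + (A.wordMatrix w p q + A.F q) = k := by
    rw [← add_assoc, ← hq, ← hp]; exact h
  obtain ⟨i, j, hi, hj, hij⟩ := WithBot.add_eq_coe.1 h'
  exact ⟨p, i, j, hi.symm, hasRun_of_eq hj.symm, hij.symm⟩

/-- Since the maxima are finite, a finite weight is attained by a run. This removes `⊥` from the
estimates: a word without accepting runs of `B` must have none of `A`. -/
theorem isBigO_iff {A : MaxPlusAutomaton Q S} {B : MaxPlusAutomaton P S} :
    A.IsBigO B ↔ ∃ c : ℕ, 0 < c ∧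
      ∀ w k, A.Accepts w k → ∃ l, B.Accepts w l ∧ k ≤ c * l + c := by
  refine exists_congr fun c => and_congr_right fun hc => forall_congr' fun w => ⟨?_, ?_⟩
  · intro h k hk
    have h' := hk.le_weight.trans h
    obtain hB | ⟨l, hB⟩ := NMax.eq_bot_or_coe (B.weight w)
    · rw [hB, WithBot.mul_bot (by exact_mod_cast hc.ne')] at h'
      simp at h'
    · refine ⟨l, accepts_of_weight_eq hB, ?_⟩
      rw [hB] at h'
      exact WithBot.coe_le_coe.1 h'
  · intro h
    obtain hA | ⟨k, hA⟩ := NMax.eq_bot_or_coe (A.weight w)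
    · rw [hA]; exact bot_le
    · rw [hA]
      obtain ⟨l, hl, hkl⟩ := h k (accepts_of_weight_eq hA)
      have hl' := hl.le_weight
      obtain hB | ⟨l', hB⟩ := NMax.eq_bot_or_coe (B.weight w)
      · rw [hB] at hl'
        exact absurd hl' (by simp)
      · rw [hB] at hl'
        have h1 : l ≤ l' := WithBot.coe_le_coe.1 hl'
        have h2 : k ≤ c * l' + c := hkl.trans (by gcongr)
        rw [hB]
        exact WithBot.coe_le_coe.2 h2

theorem wordMatrix_singleton_ne_bot {A : MaxPlusAutomaton Q S} {a : S} {p q : Q}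
    (h : A.M a p q ≠ ⊥) : A.wordMatrix [a] p q ≠ ⊥ := by
  have h1 : A.M a p q + mpOne q q ≤ A.wordMatrix [a] p q :=
    Finset.le_sup (f := fun r => A.M a p r + (mpOne r q : NMax)) (Finset.mem_univ q)
  have h2 : (mpOne q q : NMax) = 0 := if_pos rfl
  rw [h2, add_zero] at h1
  exact fun h3 => h (le_bot_iff.1 (h1.trans h3.le))

end Runs

end MaxPlusAutomaton

/-! ### The deterministic and the total automaton, and the equivalence of the two big-O questions.
-/

namespace MaxPlusAutomaton

section Reduction

variable {m n s : ℕ}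

/-- The marker for the beginning of a word. -/
def startMark : Fin (s + 3) := 0
/-- The marker for the end of a word. -/
def stopMark : Fin (s + 3) := Fin.succ 0
/-- The marker that allows arbitrary transitions. -/
def jumpMark : Fin (s + 3) := Fin.succ (Fin.succ 0)
/-- The original letters. -/
def letterMark (a : Fin s) : Fin (s + 3) := a.succ.succ.succ

theorem mark_cases (x : Fin (s + 3)) :
    x = startMark ∨ x = stopMark ∨ x = jumpMark ∨ ∃ a, x = letterMark a := by
  refine Fin.cases (.inl rfl) (fun x => ?_) x
  refine Fin.cases (.inr (.inl rfl)) (fun x => ?_) x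
  exact Fin.cases (.inr (.inr (.inl rfl))) (fun a => .inr (.inr (.inr ⟨a, rfl⟩))) x

theorem jumpMark_ne_stopMark : (jumpMark : Fin (s + 3)) ≠ stopMark := fun h =>
  Fin.succ_ne_zero _ (Fin.succ_injective _ h)

theorem jumpMark_ne_startMark : (jumpMark : Fin (s + 3)) ≠ startMark := fun h =>
  Fin.succ_ne_zero _ h

theorem jumpMark_ne_letterMark (a : Fin s) : jumpMark ≠ letterMark a := fun h =>
  Fin.succ_ne_zero _ (Fin.succ_injective _ (Fin.succ_injective _ h)).symm

/-- `2 x + 1`, for a weight `x`. -/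
def boost (x : NMax) : NMax := WithBot.map (fun k => 2 * k + 1) x

/-- The matrix of an automaton with an additional state, the hub, given the weights from the hub,
to the hub, and between the other states. -/
def bordered (h f : Fin m → NMax) (D : Matrix (Fin m) (Fin m) NMax) :
    Matrix (Fin (m + 1)) (Fin (m + 1)) NMax :=
  Matrix.vecCons (Matrix.vecCons ⊥ h) fun p => Matrix.vecCons (f p) (D p)

/-- The matrices of the automaton with a hub. -/
def hubMatrix (A : MaxPlusAutomaton (Fin m) (Fin s)) :
    Fin (s + 3) → Matrix (Fin (m + 1)) (Fin (m + 1)) NMax :=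
  Matrix.vecCons (bordered A.I (fun _ => ⊥) fun _ _ => ⊥) <|
  Matrix.vecCons (bordered (fun _ => ⊥) (fun p => boost (A.F p)) fun _ _ => ⊥) <|
  Matrix.vecCons (fun _ _ => 0) fun a => bordered (fun _ => ⊥) (fun _ => ⊥) (A.M a)

/-- The deterministic automaton with a hub: every letter prescribes the target state. -/
def determinized (A : MaxPlusAutomaton (Fin m) (Fin s)) (S : Type)
    (π : S → Fin (s + 3) × Fin (m + 1)) : MaxPlusAutomaton (Fin (m + 1)) S where
  M l p q := if q = (π l).2 then A.hubMatrix (π l).1 p q else ⊥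
  I := Matrix.vecCons 0 fun _ => ⊥
  F := Matrix.vecCons 0 fun _ => ⊥

/-- The matrix of an automaton with three additional states: a hub with a loop of weight `0`, and
two states with a loop of weight `1`. -/
def padded (h f : Fin n → NMax) (D : Matrix (Fin n) (Fin n) NMax) :
    Matrix (Fin (n + 3)) (Fin (n + 3)) NMax :=
  Matrix.vecCons (Matrix.vecCons 0 <| Matrix.vecCons ⊥ <| Matrix.vecCons ⊥ h) <|
  Matrix.vecCons (Matrix.vecCons ⊥ <| Matrix.vecCons 1 <| Matrix.vecCons ⊥ fun _ => ⊥) <|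
  Matrix.vecCons (Matrix.vecCons ⊥ <| Matrix.vecCons ⊥ <| Matrix.vecCons 1 fun _ => ⊥) fun p =>
  Matrix.vecCons (f p) <| Matrix.vecCons ⊥ <| Matrix.vecCons ⊥ (D p)

/-- The hub automaton that may ignore words, and that counts letters where a jump occurs. -/
def totalized (B : MaxPlusAutomaton (Fin n) (Fin s)) :
    MaxPlusAutomaton (Fin (n + 3)) (Fin (s + 3)) where
  M := Matrix.vecCons (padded B.I (fun _ => ⊥) fun _ _ => ⊥) <|
    Matrix.vecCons (padded (fun _ => ⊥) (fun p => boost (B.F p)) fun _ _ => ⊥) <|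
    Matrix.vecCons (fun _ _ => 1) fun a => padded (fun _ => ⊥) (fun _ => ⊥) (B.M a)
  I := Matrix.vecCons 0 <| Matrix.vecCons 0 fun _ => ⊥
  F := Matrix.vecCons 0 <| Matrix.vecCons ⊥ <| Matrix.vecCons 0 fun _ => ⊥

/-- The hub of `totalized`. -/
def hub : Fin (n + 3) := 0
/-- The counting state of `totalized` before the first jump. -/
def counter : Fin (n + 3) := Fin.succ 0
/-- The counting state of `totalized` after a jump. -/
def counter' : Fin (n + 3) := Fin.succ (Fin.succ 0)
/-- The original states in `totalized`. -/
def inner (p : Fin n) : Fin (n + 3) := p.succ.succ.succ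

theorem state_cases (x : Fin (n + 3)) :
    x = hub ∨ x = counter ∨ x = counter' ∨ ∃ p, x = inner p :=
  mark_cases x

theorem eq_of_boost_eq {x : NMax} {k : ℕ} (h : boost x = k) : ∃ j : ℕ, x = j ∧ k = 2 * j + 1 := by
  obtain rfl | ⟨j, rfl⟩ := NMax.eq_bot_or_coe x
  · exact absurd h WithBot.bot_ne_coe
  · exact ⟨j, rfl, (WithBot.coe_injective h).symm⟩

theorem eq_zero_of_zero_eq {k : ℕ} (h : (0 : NMax) = k) : k = 0 := by exact_mod_cast h.symm

variable {A : MaxPlusAutomaton (Fin m) (Fin s)} {B : MaxPlusAutomaton (Fin n) (Fin s)}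

section Totalized

theorem totalized_hasRun_hub_zero (x : List (Fin (s + 3))) : ∃ k, B.totalized.HasRun x hub k := by
  induction x with
  | nil => exact ⟨0, rfl⟩
  | cons x w ih =>
    obtain ⟨k, hk⟩ := ih
    obtain rfl | rfl | rfl | ⟨a, rfl⟩ := mark_cases x
    · exact ⟨_, hub, 0, k, rfl, hk, rfl⟩
    · exact ⟨_, hub, 0, k, rfl, hk, rfl⟩
    · exact ⟨_, hub, 1, k, rfl, hk, rfl⟩
    · exact ⟨_, hub, 0, k, rfl, hk, rfl⟩

theorem totalized_hasRun_counter' (w : List (Fin (s + 3))) :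
    B.totalized.HasRun w counter' w.length := by
  induction w with
  | nil => exact rfl
  | cons x w ih =>
    refine ⟨counter', 1, w.length, ?_, ih, by simp [add_comm]⟩
    obtain rfl | rfl | rfl | ⟨a, rfl⟩ := mark_cases x <;> rfl

/-- The run counts in `counter` and moves to the final state `counter'` at the first jump, paying 1
for every letter. -/
theorem totalized_hasRun_counter {w : List (Fin (s + 3))} (h : jumpMark ∈ w) :
    B.totalized.HasRun w counter w.length := by
  induction w with
  | nil => simp at h
  | cons x w ih =>
    by_cases hx : jumpMark = x
    · subst hx
      exact ⟨counter', 1, w.length, rfl, totalized_hasRun_counter' w, by simp [add_comm]⟩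
    · have hw : jumpMark ∈ w := (List.mem_cons.1 h).resolve_left hx
      refine ⟨counter, 1, w.length, ?_, ih hw, by simp [add_comm]⟩
      obtain rfl | rfl | rfl | ⟨a, rfl⟩ := mark_cases x
      · rfl
      · rfl
      · exact absurd rfl hx
      · rfl

/-- Only a jump leaves `counter`, which is not final. Hence the counting states add nothing on words
made of blocks. -/
theorem not_totalized_hasRun_counter {w : List (Fin (s + 3))} (h : jumpMark ∉ w) (k : ℕ) :
    ¬ B.totalized.HasRun w counter k := by
  induction w generalizing k with
  | nil => exact fun h => WithBot.bot_ne_coe h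
  | cons x w ih =>
    rintro ⟨r, y, z, hy, hz, rfl⟩
    simp only [List.mem_cons, not_or] at h
    obtain rfl | rfl | rfl | ⟨p, rfl⟩ := state_cases r
    · obtain rfl | rfl | rfl | ⟨a, rfl⟩ := mark_cases x
      exacts [WithBot.bot_ne_coe hy, WithBot.bot_ne_coe hy, h.1 rfl, WithBot.bot_ne_coe hy]
    · exact ih h.2 _ hz
    · obtain rfl | rfl | rfl | ⟨a, rfl⟩ := mark_cases x
      exacts [WithBot.bot_ne_coe hy, WithBot.bot_ne_coe hy, h.1 rfl, WithBot.bot_ne_coe hy]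
    · obtain rfl | rfl | rfl | ⟨a, rfl⟩ := mark_cases x
      exacts [WithBot.bot_ne_coe hy, WithBot.bot_ne_coe hy, h.1 rfl, WithBot.bot_ne_coe hy]

theorem totalized_hasRun_hub_of_inner {w : List (Fin s)} {rest : List (Fin (s + 3))} {v : ℕ}
    (h : B.totalized.HasRun (w.map letterMark ++ stopMark :: rest) hub v) :
    B.totalized.HasRun rest hub v := by
  induction w generalizing v with
  | nil =>
    obtain ⟨r, y, z, hy, hz, rfl⟩ := h
    obtain rfl | rfl | rfl | ⟨p, rfl⟩ := state_cases r
    · rwa [eq_zero_of_zero_eq hy, zero_add]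
    all_goals exact absurd hy WithBot.bot_ne_coe
  | cons a w ih =>
    obtain ⟨r, y, z, hy, hz, rfl⟩ := h
    obtain rfl | rfl | rfl | ⟨p, rfl⟩ := state_cases r
    · rw [eq_zero_of_zero_eq hy, zero_add]
      exact ih hz
    all_goals exact absurd hy WithBot.bot_ne_coe

theorem exists_hasRun_of_totalized {w : List (Fin s)} {rest : List (Fin (s + 3))} {p : Fin n}
    {v : ℕ} (h : B.totalized.HasRun (w.map letterMark ++ stopMark :: rest) (inner p) v) :
    ∃ y z, B.HasRun w p y ∧ B.totalized.HasRun rest hub z ∧ v ≤ 2 * y + 1 + z := by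
  induction w generalizing p v with
  | nil =>
    obtain ⟨r, y, z, hy, hz, rfl⟩ := h
    obtain rfl | rfl | rfl | ⟨q, rfl⟩ := state_cases r
    · obtain ⟨j, hj, rfl⟩ := eq_of_boost_eq hy
      exact ⟨j, z, hj, hz, le_rfl⟩
    all_goals exact absurd hy WithBot.bot_ne_coe
  | cons a w ih =>
    obtain ⟨r, y, z, hy, hz, rfl⟩ := h
    obtain rfl | rfl | rfl | ⟨q, rfl⟩ := state_cases r
    · exact absurd hy WithBot.bot_ne_coe
    · exact absurd hy WithBot.bot_ne_coe
    · exact absurd hy WithBot.bot_ne_coe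
    · obtain ⟨y', z', hy', hz', hle⟩ := ih hz
      exact ⟨y + y', z', ⟨q, y, y', hy, hy', rfl⟩, hz', by omega⟩

/-- At the start mark the run either stays in the hub, and then ignores the whole block for free, or
enters `B`, and then returns exactly at the stop mark. Only the final weight is doubled, whence the
upper bound `2 * l + 1`. -/
theorem exists_accepts_of_totalized_block {w : List (Fin s)} {rest : List (Fin (s + 3))} {v : ℕ}
    (h : B.totalized.HasRun (startMark :: (w.map letterMark ++ stopMark :: rest)) hub v) :
    B.totalized.HasRun rest hub v ∨
      ∃ l z, B.Accepts w l ∧ B.totalized.HasRun rest hub z ∧ v ≤ 2 * l + 1 + z := by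
  obtain ⟨r, y, z, hy, hz, rfl⟩ := h
  obtain rfl | rfl | rfl | ⟨p, rfl⟩ := state_cases r
  · left
    rw [eq_zero_of_zero_eq hy, zero_add]
    exact totalized_hasRun_hub_of_inner hz
  · exact absurd hy WithBot.bot_ne_coe
  · exact absurd hy WithBot.bot_ne_coe
  · right
    obtain ⟨y', z', hy', hz', hle⟩ := exists_hasRun_of_totalized hz
    exact ⟨y + y', z', ⟨p, y, y', hy, hy', rfl⟩, hz', by omega⟩

/-- The word that presents `w` between markers. -/
def block (w : List (Fin s)) : List (Fin (s + 3)) := startMark :: (w.map letterMark ++ [stopMark])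

/-- Different copies may be read by different runs of `B`; the largest of their weights serves for
all copies. -/
theorem exists_accepts_of_totalized_blocks {w : List (Fin s)} (N : ℕ) {v : ℕ}
    (h : B.totalized.HasRun (List.replicate N (block w)).flatten hub v) :
    v = 0 ∨ ∃ l, B.Accepts w l ∧ v ≤ N * (2 * l + 1) := by
  induction N generalizing v with
  | zero => exact .inl (eq_zero_of_zero_eq h)
  | succ N ih =>
    have h' : B.totalized.HasRun (startMark :: (w.map letterMark ++
        stopMark :: (List.replicate N (block w)).flatten)) hub v := by
      simpa [List.replicate_succ, block] using h
    rcases exists_accepts_of_totalized_block h' with h1 | ⟨l, z, hl, hz, hle⟩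
    · refine (ih h1).imp_right ?_
      rintro ⟨l, hl, hle⟩
      exact ⟨l, hl, hle.trans (Nat.mul_le_mul_right _ N.le_succ)⟩
    · right
      rcases ih hz with rfl | ⟨l', hl', hle'⟩
      · exact ⟨l, hl, by nlinarith⟩
      · rcases le_total l l' with hll | hll
        · exact ⟨l', hl', by nlinarith⟩
        · exact ⟨l, hl, by nlinarith [Nat.mul_le_mul_left N hll]⟩

theorem jumpMark_notMem_blocks (w : List (Fin s)) (N : ℕ) :
    jumpMark ∉ (List.replicate N (block w)).flatten := by
  simp only [List.mem_flatten, List.mem_replicate, not_exists, not_and, block, and_imp]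
  rintro _ - rfl h
  simp only [List.mem_cons, List.mem_append, List.mem_map, List.not_mem_nil, or_false] at h
  rcases h with h | ⟨a, -, h⟩ | h
  exacts [jumpMark_ne_startMark h, jumpMark_ne_letterMark a h.symm, jumpMark_ne_stopMark h]

theorem totalized_hasRun_inner_append {w : List (Fin s)} {rest : List (Fin (s + 3))} {p : Fin n}
    {y z : ℕ} (hy : B.HasRun w p y) (hz : B.totalized.HasRun rest hub z) :
    ∃ v, y + 1 + z ≤ v ∧ B.totalized.HasRun (w.map letterMark ++ stopMark :: rest) (inner p) v := by
  induction w generalizing p y with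
  | nil =>
    refine ⟨2 * y + 1 + z, by omega, hub, 2 * y + 1, z, ?_, hz, rfl⟩
    exact congrArg boost hy
  | cons a w ih =>
    obtain ⟨r, x, y, hx, hy, rfl⟩ := hy
    obtain ⟨v, hv, hrun⟩ := ih hy
    exact ⟨x + v, by omega, inner r, x, v, hx, hrun, rfl⟩

theorem totalized_hasRun_block_append {w : List (Fin s)} {rest : List (Fin (s + 3))} {l z : ℕ}
    (hl : B.Accepts w l) (hz : B.totalized.HasRun rest hub z) :
    ∃ v, l + 1 + z ≤ v ∧
      B.totalized.HasRun (startMark :: (w.map letterMark ++ stopMark :: rest)) hub v := by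
  obtain ⟨p, i, j, hi, hj, rfl⟩ := hl
  obtain ⟨v, hv, hrun⟩ := totalized_hasRun_inner_append hj hz
  exact ⟨i + v, by omega, inner p, i, v, hi, hrun, rfl⟩

end Totalized

section Determinized

variable {S : Type} {π : S → Fin (s + 3) × Fin (m + 1)}

theorem determinized_target {l : S} {p q : Fin (m + 1)} {k : ℕ}
    (h : (A.determinized S π).M l p q = k) :
    q = (π l).2 ∧ A.hubMatrix (π l).1 p q = k := by
  by_cases hq : q = (π l).2
  · exact ⟨hq, by simpa [determinized, hq] using h⟩
  · simp [determinized, hq] at h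

theorem determinized_M_of_eq {l : S} {x : Fin (s + 3)} {q : Fin (m + 1)} (hl : π l = (x, q))
    (p : Fin (m + 1)) : (A.determinized S π).M l p q = A.hubMatrix x p q := by
  simp [determinized, hl]

/-- Without jumps, a run that starts inside `A` can end only after a return to the hub, and a stop
mark is the only way back. The first return cuts off the rest of the block. -/
theorem exists_block_of_determinized {u : List S} {q : Fin m} {k : ℕ}
    (hu : jumpMark ∉ u.map fun l => (π l).1) (h : (A.determinized S π).HasRun u q.succ k) :
    ∃ w j k' u', A.HasRun w q j ∧ (A.determinized S π).HasRun u' 0 k' ∧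
      k ≤ 2 * j + 1 + k' ∧ u'.length < u.length ∧
      (u.map fun l => (π l).1) = w.map letterMark ++ stopMark :: u'.map fun l => (π l).1 := by
  induction u generalizing q k with
  | nil => exact absurd h WithBot.bot_ne_coe
  | cons l u ih =>
    obtain ⟨r, x, y, hx, hy, rfl⟩ := h
    obtain ⟨hr, hx⟩ := determinized_target hx
    simp only [List.map_cons, List.mem_cons, not_or] at hu
    obtain ⟨hu1, hu⟩ := hu
    simp only [List.map_cons]
    obtain hm | hm | hm | ⟨a, hm⟩ := mark_cases (π l).1 <;> rw [hm] at hx <;>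
      refine Fin.cases (fun hx hy => ?_) (fun r hx hy => ?_) r hx hy
    · exact absurd hx WithBot.bot_ne_coe
    · exact absurd hx WithBot.bot_ne_coe
    · obtain ⟨j, hj, rfl⟩ := eq_of_boost_eq hx
      exact ⟨[], j, y, u, hj, hy, le_rfl, by simp, by simp [hm]⟩
    · exact absurd hx WithBot.bot_ne_coe
    · exact absurd hm.symm hu1
    · exact absurd hm.symm hu1
    · exact absurd hx WithBot.bot_ne_coe
    · obtain ⟨w, j, k', u', hw, hu', hle, hlen, heq⟩ := ih hu hy
      exact ⟨a :: w, x + j, k', u', ⟨r, x, j, hx, hw, rfl⟩, hu', by omega,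
        hlen.trans (by simp), by simp [hm, heq]⟩

/-- Block by block, with a strong induction because blocks vary in length. A block of value `i` in
`A` costs at most `2 * i + 1`, and `i ≤ c * l + c` gives `2 * i + 1 ≤ (2 * c + 1) * (l + 1)`, while
`B` gains at least `l + 1`. No additive constant is left to accumulate. -/
theorem exists_totalized_hasRun_of_determinized {c : ℕ}
    (hc : ∀ w k, A.Accepts w k → ∃ l, B.Accepts w l ∧ k ≤ c * l + c) {u : List S} {k : ℕ}
    (hu : jumpMark ∉ u.map fun l => (π l).1) (h : (A.determinized S π).HasRun u 0 k) :
    ∃ z, B.totalized.HasRun (u.map fun l => (π l).1) hub z ∧ k ≤ (2 * c + 1) * z := by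
  induction hn : u.length using Nat.strong_induction_on generalizing u k with
  | _ N ih =>
  subst hn
  rcases u with _ | ⟨l, u⟩
  · exact ⟨0, rfl, (eq_zero_of_zero_eq h).le⟩
  obtain ⟨r, x, y, hx, hy, rfl⟩ := h
  obtain ⟨hr, hx⟩ := determinized_target hx
  simp only [List.map_cons, List.mem_cons, not_or] at hu
  obtain ⟨hu1, hu⟩ := hu
  simp only [List.map_cons]
  obtain hm | hm | hm | ⟨a, hm⟩ := mark_cases (π l).1 <;> rw [hm] at hx <;>
    refine Fin.cases (fun hx hy => ?_) (fun r hx hy => ?_) r hx hy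
  · exact absurd hx WithBot.bot_ne_coe
  · obtain ⟨w, j, k', u', hw, hu', hle, hlen, heq⟩ := exists_block_of_determinized hu hy
    obtain ⟨z, hz, hkz⟩ := ih u'.length (hlen.trans (by simp))
      (fun hj => hu (by rw [heq]; simp [hj])) hu' rfl
    obtain ⟨i, hi, hil⟩ := hc w (x + j) ⟨r, x, j, hx, hw, rfl⟩
    obtain ⟨v, hv, hrun⟩ := totalized_hasRun_block_append hi hz
    refine ⟨v, by rw [hm, heq]; exact hrun, ?_⟩
    nlinarith [Nat.mul_le_mul_left (2 * c + 1) hv]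
  · exact absurd hx WithBot.bot_ne_coe
  · exact absurd hx WithBot.bot_ne_coe
  · exact absurd hm.symm hu1
  · exact absurd hm.symm hu1
  · exact absurd hx WithBot.bot_ne_coe
  · exact absurd hx WithBot.bot_ne_coe

/-- The largest finite matrix entry serves as `W`; initial and final weights of the hub are 0, so no
additive constant is needed. -/
theorem exists_hasRun_le_mul_length : ∃ W : ℕ, ∀ u p k,
    (A.determinized S π).HasRun u p k → k ≤ W * u.length := by
  obtain ⟨W, hW⟩ : ∃ W : ℕ, ∀ x p q, A.hubMatrix x p q ≤ W := by
    obtain ⟨W, hW⟩ := (Set.finite_range fun i : Fin (s + 3) × Fin (m + 1) × Fin (m + 1) =>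
      WithBot.unbotD 0 (A.hubMatrix i.1 i.2.1 i.2.2)).bddAbove
    refine ⟨W, fun x p q => ?_⟩
    have := hW ⟨(x, p, q), rfl⟩
    obtain h | ⟨k, h⟩ := NMax.eq_bot_or_coe (A.hubMatrix x p q)
    · simp [h]
    · simp only [h] at this ⊢
      exact WithBot.coe_le_coe.2 this
  refine ⟨W, fun u => ?_⟩
  induction u with
  | nil =>
    intro p k h
    refine Fin.cases (fun h => ?_) (fun p h => absurd h WithBot.bot_ne_coe) p h
    exact (eq_zero_of_zero_eq h).le
  | cons l u ih =>
    rintro p k ⟨r, x, y, hx, hy, rfl⟩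
    obtain ⟨-, hx⟩ := determinized_target hx
    have h1 : x ≤ W := WithBot.coe_le_coe.1 (hx.symm.le.trans (hW _ _ _))
    have h2 := ih _ _ hy
    simp only [List.length_cons]
    nlinarith

theorem exists_determinized_hasRun_append (hπ : Function.Surjective π) {w : List (Fin s)}
    {q : Fin m} {j : ℕ} (h : A.HasRun w q j) :
    ∃ u : List S, (u.map fun l => (π l).1) = w.map letterMark ++ [stopMark] ∧
      ∀ u' k', (A.determinized S π).HasRun u' 0 k' →
        ∃ k, j + 1 + k' ≤ k ∧ (A.determinized S π).HasRun (u ++ u') q.succ k := by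
  induction w generalizing q j with
  | nil =>
    obtain ⟨l, hl⟩ := hπ (stopMark, 0)
    refine ⟨[l], by simp [hl], fun u' k' h' => ⟨2 * j + 1 + k', by omega, 0, 2 * j + 1, k', ?_, h',
      rfl⟩⟩
    rw [determinized_M_of_eq hl]
    exact congrArg boost h
  | cons a w ih =>
    obtain ⟨r, x, y, hx, hy, rfl⟩ := h
    obtain ⟨u, hu, hrun⟩ := ih hy
    obtain ⟨l, hl⟩ := hπ (letterMark a, r.succ)
    refine ⟨l :: u, by simp [hl, hu], fun u' k' h' => ?_⟩
    obtain ⟨k, hk, hk'⟩ := hrun u' k' h'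
    refine ⟨x + k, by omega, r.succ, x, k, ?_, hk', rfl⟩
    rw [determinized_M_of_eq hl]
    exact hx

/-- Surjectivity of `π` supplies, for each mark, the letter whose prescribed target is the next
state of the chosen run. -/
theorem exists_determinized_hasRun_blocks (hπ : Function.Surjective π) {w : List (Fin s)} {k : ℕ}
    (h : A.Accepts w k) (N : ℕ) :
    ∃ u : List S, (u.map fun l => (π l).1) = (List.replicate N (block w)).flatten ∧
      ∃ v, N * (k + 1) ≤ v ∧ (A.determinized S π).HasRun u 0 v := by
  obtain ⟨q, i, j, hi, hj, rfl⟩ := h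
  obtain ⟨u, hu, hrun⟩ := exists_determinized_hasRun_append (A := A) hπ hj
  obtain ⟨l, hl⟩ := hπ (startMark, q.succ)
  induction N with
  | zero => exact ⟨[], rfl, 0, by simp, rfl⟩
  | succ N ih =>
    obtain ⟨u', hu', v, hv, hv'⟩ := ih
    obtain ⟨v', hle, hv'⟩ := hrun u' v hv'
    refine ⟨l :: (u ++ u'), by simp [hl, hu, hu', block, List.replicate_succ], i + v',
      by nlinarith, q.succ, i, v', ?_, hv', rfl⟩
    rw [determinized_M_of_eq hl]
    exact hi

theorem accepts_determinized_iff {u : List S} {k : ℕ} :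
    (A.determinized S π).Accepts u k ↔ (A.determinized S π).HasRun u 0 k := by
  constructor
  · rintro ⟨p, i, j, hi, hj, rfl⟩
    refine Fin.cases (fun hi hj => ?_) (fun p hi _ => absurd hi WithBot.bot_ne_coe) p hi hj
    rwa [eq_zero_of_zero_eq hi, zero_add]
  · exact fun h => ⟨0, 0, k, rfl, h, (zero_add k).symm⟩

/-- The big-O property is invariant under making the first automaton deterministic and the second
one total. -/
theorem determinized_isBigO_iff (hπ : Function.Surjective π) :
    (A.determinized S π).IsBigO (B.totalized.relabel fun l => (π l).1) ↔ A.IsBigO B := by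
  rw [isBigO_iff, isBigO_iff]
  constructor
  · rintro ⟨c, hc, h⟩
    -- The block of `w` is repeated `c + 1` times, one more than the additive constant can absorb.
    refine ⟨2 * c, by omega, fun w k hk => ?_⟩
    obtain ⟨u, hu, v, hv, hrun⟩ := exists_determinized_hasRun_blocks hπ hk (c + 1)
    obtain ⟨l, ⟨p, i, j, hi, hj, rfl⟩, hle⟩ := h u v (accepts_determinized_iff.2 hrun)
    rw [hasRun_relabel, hu] at hj
    obtain rfl | rfl | rfl | ⟨q, rfl⟩ := state_cases p
    · obtain rfl := eq_zero_of_zero_eq hi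
      rcases exists_accepts_of_totalized_blocks _ hj with rfl | ⟨l, hl, hl'⟩
      -- If all blocks were ignored, `(c + 1) * (k + 1) ≤ c` would follow, which is absurd; so `B`
      -- accepts `w`.
      · nlinarith
      · refine ⟨l, hl, ?_⟩
        have h1 : (c + 1) * (k + 1) ≤ c * ((c + 1) * (2 * l + 1)) + c :=
          hv.trans (hle.trans (by rw [zero_add]; gcongr))
        -- The additive `c` is smaller than one further multiple of `c + 1`, so division by `c + 1`
        -- leaves `k < c * (2 * l + 1)`.
        have h2 : (c + 1) * (k + 1) < (c + 1) * (c * (2 * l + 1) + 1) := by nlinarith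
        have h3 := lt_of_mul_lt_mul_left h2 (Nat.zero_le _)
        nlinarith
    · exact absurd hj (not_totalized_hasRun_counter (jumpMark_notMem_blocks w _) _)
    · exact absurd hi WithBot.bot_ne_coe
    · exact absurd hi WithBot.bot_ne_coe
  · rintro ⟨c, hc, h⟩
    obtain ⟨W, hW⟩ := exists_hasRun_le_mul_length (A := A) (π := π)
    -- `W` serves the words with a jump, where the counting states give the length, and `2 * c + 1`
    -- serves the others.
    refine ⟨W + (2 * c + 1), by omega, fun u k hk => ?_⟩
    rw [accepts_determinized_iff] at hk
    by_cases hu : jumpMark ∈ u.map fun l => (π l).1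
    · refine ⟨u.length, ⟨counter, 0, u.length, rfl, ?_, by simp⟩, ?_⟩
      · rw [hasRun_relabel]
        simpa using totalized_hasRun_counter (B := B) hu
      · have := hW _ _ _ hk
        nlinarith
    · obtain ⟨z, hz, hkz⟩ := exists_totalized_hasRun_of_determinized h hu hk
      refine ⟨z, ⟨hub, 0, z, rfl, ?_, by simp⟩, by nlinarith⟩
      rwa [hasRun_relabel]

theorem determinized_isDeterministic : (A.determinized S π).IsDeterministic := by
  constructor
  · intro p q
    refine Fin.cases ?_ (fun p h => absurd rfl h) p
    exact fun _ => Fin.cases (fun _ => rfl) (fun q h => absurd rfl h) q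
  · intro l p q r hq hr
    simp only [determinized, ne_eq, ite_eq_right_iff, Classical.not_imp] at hq hr
    rw [hq.1, hr.1]

theorem zero_ne_bot : (0 : NMax) ≠ ⊥ := WithBot.coe_ne_bot

/-- A single jump joins any two states, so every state is one letter away from the hub in both
directions. -/
theorem determinized_isTrim (hπ : Function.Surjective π) : (A.determinized S π).IsTrim := by
  intro q
  have hjump : ∀ p q, ∃ l, (A.determinized S π).M l p q ≠ ⊥ := by
    intro p q
    obtain ⟨l, hl⟩ := hπ (jumpMark, q)
    exact ⟨l, by rw [determinized_M_of_eq hl]; exact zero_ne_bot⟩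
  obtain ⟨l, hl⟩ := hjump 0 q
  obtain ⟨l', hl'⟩ := hjump q 0
  exact ⟨⟨[l], 0, zero_ne_bot, wordMatrix_singleton_ne_bot hl⟩,
    [l'], 0, wordMatrix_singleton_ne_bot hl', zero_ne_bot⟩

theorem totalized_isTrim (hπ : Function.Surjective π) :
    (B.totalized.relabel fun l => (π l).1).IsTrim := by
  intro q
  obtain ⟨l, hl⟩ := hπ (jumpMark, 0)
  have hjump : ∀ p q, (B.totalized.relabel fun l => (π l).1).M l p q ≠ ⊥ := by
    intro p q
    simp only [relabel, hl]
    exact WithBot.coe_ne_bot (a := 1)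
  exact ⟨⟨[l], hub, zero_ne_bot, wordMatrix_singleton_ne_bot (hjump _ _)⟩,
    [l], hub, wordMatrix_singleton_ne_bot (hjump _ _), zero_ne_bot⟩

theorem totalized_weight_ne_bot (u : List S) :
    (B.totalized.relabel fun l => (π l).1).weight u ≠ ⊥ := by
  obtain ⟨k, hk⟩ := totalized_hasRun_hub_zero (B := B) (u.map fun l => (π l).1)
  have h : (B.totalized.relabel fun l => (π l).1).Accepts u (0 + k) :=
    ⟨hub, 0, k, rfl, (hasRun_relabel _ _ _ _ _).2 hk, rfl⟩
  intro hbot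
  have := h.le_weight
  rw [hbot] at this
  simp at this

end Determinized

end Reduction

end MaxPlusAutomaton

/-! ### Locating the entries of an encoded instance. -/

/-- The `k`-th piece of a word, where the pieces end with the separators. -/
def piece : List Token → ℕ → List Token
  | [], _ => []
  | .sep :: _, 0 => [.sep]
  | .sep :: w, k + 1 => piece w k
  | t :: w, k => (if k = 0 then [t] else []) ++ piece w k

theorem piece_cons_of_ne {t : Token} (ht : t ≠ .sep) (w : List Token) (k : ℕ) :
    piece (t :: w) k = (if k = 0 then [t] else []) ++ piece w k := by
  cases t <;> first | rfl | exact absurd rfl ht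

/-- A symbol belongs to the piece numbered by the separators before it. In this form a piece is the
output of a loop over the positions, as `flatMap_symbols` requires. -/
theorem piece_eq_flatMap (w : List Token) (k : ℕ) :
    piece w k = (List.finRange w.length).flatMap fun j : Fin w.length =>
      if (w.take j).count .sep = k then [w[j]] else [] := by
  induction w generalizing k with
  | nil => rfl
  | cons t w ih =>
    simp only [List.length_cons, List.finRange_succ, List.flatMap_cons, List.flatMap_map]
    by_cases ht : t = .sep
    · subst ht
      cases k with
      | zero => simp [piece]
      | succ k => simp [piece, ih]
    · rw [piece_cons_of_ne ht, ih]
      simp [ht, eq_comm]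

theorem piece_append_sep {c : List Token} (hc : .sep ∉ c) (w : List Token) (k : ℕ) :
    piece (c ++ .sep :: w) k = if k = 0 then c ++ [.sep] else piece w (k - 1) := by
  induction c with
  | nil => cases k <;> rfl
  | cons t c ih =>
    simp only [List.mem_cons, not_or] at hc
    rw [List.cons_append, piece_cons_of_ne (Ne.symm hc.1), ih hc.2]
    split_ifs <;> rfl

theorem piece_flatten {l : List (List Token)} (hl : ∀ c ∈ l, ∃ c', .sep ∉ c' ∧ c = c' ++ [.sep])
    {k : ℕ} {c : List Token} (hk : l[k]? = some c) : piece l.flatten k = c := by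
  induction l generalizing k with
  | nil => simp at hk
  | cons d l ih =>
    obtain ⟨c', hc', rfl⟩ := hl d (by simp)
    rw [List.flatten_cons, List.append_assoc, List.singleton_append, piece_append_sep hc']
    cases k with
    | zero => simpa using hk
    | succ k => exact ih (fun c h => hl c (by simp [h])) (by simpa using hk)

theorem exists_encodeWeight_eq (x : NMax) : ∃ c, .sep ∉ c ∧ encodeWeight x = c ++ [.sep] := by
  obtain rfl | ⟨k, rfl⟩ := NMax.eq_bot_or_coe x
  · exact ⟨[.negInf], by simp, rfl⟩
  · exact ⟨k.bits.map .bit, by simp, rfl⟩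

theorem count_take_sep_eq_flatMap (w : List Token) (j : ℕ) :
    List.replicate ((w.take j).count .sep) Token.tick =
      (List.finRange w.length).flatMap fun i : Fin w.length =>
        if w[i] = .sep then if (i : ℕ) + 1 ≤ j then [.tick] else [] else [] := by
  induction w generalizing j with
  | nil => simp
  | cons t w ih =>
    simp only [List.length_cons, List.finRange_succ, List.flatMap_cons, List.flatMap_map]
    cases j with
    | zero => simp
    | succ j =>
      have := ih j
      by_cases ht : t = .sep
      · subst ht
        simpa [Function.comp_def, List.replicate_succ] using this
      · simpa [Function.comp_def, ht] using this

theorem getElem?_flatMap_finRange {β : Type*} {n l : ℕ} {f : Fin n → List β}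
    (hf : ∀ i, (f i).length = l) (i : Fin n) {j : ℕ} (hj : j < l) :
    ((List.finRange n).flatMap f)[i * l + j]? = (f i)[j]? := by
  induction n with
  | zero => exact i.elim0
  | succ n ih =>
    simp only [List.finRange_succ, List.flatMap_cons, List.flatMap_map]
    refine Fin.cases ?_ (fun i => ?_) i
    · rw [List.getElem?_append_left (by simp [hf, hj])]
      simp
    · have h := ih (f := fun i => f i.succ) (fun i => hf _) i
      rw [List.getElem?_append_right (by simp [hf, Nat.succ_mul]; omega), hf, ← h]
      congr 1
      simp only [Fin.val_succ, Nat.succ_mul]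
      omega

theorem length_flatMap_finRange {β : Type*} {n l : ℕ} {f : Fin n → List β}
    (hf : ∀ i, (f i).length = l) : ((List.finRange n).flatMap f).length = n * l := by
  simp [List.length_flatMap, hf]

theorem flatMap_finRange_mul {β : Type*} (m n : ℕ) (f : Fin (m * n) → List β) :
    (List.finRange (m * n)).flatMap f =
      (List.finRange m).flatMap fun i => (List.finRange n).flatMap fun j =>
        f (finProdFinEquiv (i, j)) := by
  simp only [List.flatMap_def, ← List.ofFn_eq_map]
  rw [List.ofFn_mul, List.flatten_flatten, List.map_ofFn]
  congr 2
  funext i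
  simp only [Function.comp_apply]
  congr 2
  funext j
  congr 1
  ext
  simp [finProdFinEquiv, mul_comm, add_comm]

/-- The pieces of the encoding of an automaton. -/
def automatonPieces {n s : ℕ} (A : MaxPlusAutomaton (Fin n) (Fin s)) : List (List Token) :=
  ((List.finRange n).map fun p => encodeWeight (A.I p)) ++
  ((List.finRange n).map fun p => encodeWeight (A.F p)) ++
  ((List.finRange s).flatMap fun a => (List.finRange n).flatMap fun p =>
    (List.finRange n).map fun q => encodeWeight (A.M a p q))

theorem flatten_automatonPieces {n s : ℕ} (A : MaxPlusAutomaton (Fin n) (Fin s)) :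
    (automatonPieces A).flatten = encodeAutomaton A := by
  simp [automatonPieces, encodeAutomaton, List.flatMap_def, List.flatten_flatten,
    Function.comp_def]

section
variable {n s : ℕ} (A : MaxPlusAutomaton (Fin n) (Fin s))

theorem length_automatonPieces : (automatonPieces A).length = n + n + s * (n * n) := by
  simp [automatonPieces, List.length_flatMap, add_assoc]

theorem automatonPieces_I (p : Fin n) : (automatonPieces A)[(p : ℕ)]? = encodeWeight (A.I p) := by
  rw [automatonPieces, List.append_assoc, List.getElem?_append_left (by simp)]
  simp

theorem automatonPieces_F (p : Fin n) :
    (automatonPieces A)[n + (p : ℕ)]? = encodeWeight (A.F p) := by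
  rw [automatonPieces, List.getElem?_append_left (by simp),
    List.getElem?_append_right (by simp)]
  simp

theorem automatonPieces_M (a : Fin s) (p q : Fin n) :
    (automatonPieces A)[n + n + (a * (n * n) + (p * n + q))]? = encodeWeight (A.M a p q) := by
  rw [automatonPieces, List.getElem?_append_right (by simp)]
  have h1 : (p : ℕ) * n + q < n * n := by
    have := p.2
    have := q.2
    nlinarith
  simp only [List.length_append, List.length_map, List.length_finRange, Nat.add_sub_cancel_left]
  rw [getElem?_flatMap_finRange (l := n * n)
      (fun i => by rw [length_flatMap_finRange (l := n) (by simp)]) a h1,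
    getElem?_flatMap_finRange (l := n) (by simp) p q.2]
  simp

end

/-- The pieces of the encoding of an instance. -/
def instancePieces (x : BigOInstance) : List (List Token) :=
  [List.replicate x.s .tick ++ [.sep], List.replicate x.m .tick ++ [.sep],
    List.replicate x.n .tick ++ [.sep]] ++ (automatonPieces x.A ++ automatonPieces x.B)

theorem flatten_instancePieces (x : BigOInstance) :
    (instancePieces x).flatten = encodeInstance x := by
  simp [instancePieces, encodeInstance, flatten_automatonPieces]

theorem exists_eq_of_mem_automatonPieces {n s : ℕ} (A : MaxPlusAutomaton (Fin n) (Fin s))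
    {c : List Token} (hc : c ∈ automatonPieces A) : ∃ x, c = encodeWeight x := by
  simp only [automatonPieces, List.mem_append, List.mem_map, List.mem_flatMap] at hc
  rcases hc with (⟨p, -, rfl⟩ | ⟨p, -, rfl⟩) | ⟨a, -, p, -, q, -, rfl⟩ <;> exact ⟨_, rfl⟩

theorem piece_encodeInstance {x : BigOInstance} {k : ℕ} {c : List Token}
    (h : (instancePieces x)[k]? = some c) : piece (encodeInstance x) k = c := by
  rw [← flatten_instancePieces]
  refine piece_flatten (fun d hd => ?_) h
  simp only [instancePieces, List.cons_append, List.nil_append, List.mem_cons,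
    List.mem_append] at hd
  rcases hd with rfl | rfl | rfl | hd | hd
  iterate 3 exact ⟨_, by simp [List.mem_replicate], rfl⟩
  all_goals
    obtain ⟨y, rfl⟩ := exists_eq_of_mem_automatonPieces _ hd
    exact exists_encodeWeight_eq y

theorem piece_encodeInstance_A {x : BigOInstance} {k : ℕ} {c : List Token}
    (h : (automatonPieces x.A)[k]? = some c) : piece (encodeInstance x) (3 + k) = c := by
  refine piece_encodeInstance ?_
  obtain ⟨hk, -⟩ := List.getElem?_eq_some_iff.1 h
  rw [instancePieces, List.getElem?_append_right (by simp), List.getElem?_append_left (by simpa)]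
  simpa using h

theorem piece_encodeInstance_B {x : BigOInstance} {k : ℕ} {c : List Token}
    (h : (automatonPieces x.B)[k]? = some c) :
    piece (encodeInstance x) (3 + (x.m + x.m + x.s * (x.m * x.m)) + k) = c := by
  refine piece_encodeInstance ?_
  rw [instancePieces, List.getElem?_append_right (by simp; omega),
    List.getElem?_append_right (by simp [length_automatonPieces]; omega), length_automatonPieces,
    ← h]
  congr 1
  simp only [List.length_cons, List.length_nil]
  omega

/-- With the least significant digit first, `2 * k + 1` is `k` with a digit 1 in front, and no
carries occur. The weight `⊥` is recognized by its symbol; the test is put as a comparison of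
lengths to match `ite_length_le`. -/
theorem encodeWeight_boost (x : NMax) :
    encodeWeight (MaxPlusAutomaton.boost x) =
      if ((encodeWeight x).filter (· = Token.negInf)).length ≤ ([] : List Token).length then
        Token.bit true :: encodeWeight x else encodeWeight x := by
  obtain rfl | ⟨k, rfl⟩ := NMax.eq_bot_or_coe x
  · rfl
  · have h1 : encodeWeight (k : NMax) = k.bits.map .bit ++ [.sep] := rfl
    have h2 : encodeWeight (MaxPlusAutomaton.boost k) = (2 * k + 1).bits.map .bit ++ [.sep] := rfl
    rw [h1, h2, Nat.bit1_bits]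
    simp

/-! ### Computing unary numbers and encoded weights in polynomial space. -/

/-- The numbers `N a` can be computed, in unary. -/
def EmitsNat {V α : Type} (Γ : V → α → List Token) (N : α → ℕ) : Prop :=
  Emits Γ fun a => List.replicate (N a) Token.tick

namespace Emits

variable {V α : Type} {Γ : V → α → List Token} {f g : α → List Token} {M N : α → ℕ}

theorem congr (hf : Emits Γ f) (h : ∀ a, g a = f a) : Emits Γ g :=
  (funext h : g = f) ▸ hf

/-- Renaming of variables: it lets a program ignore loop indices on which its output does not
depend. -/
theorem comap {V' β : Type} {Γ' : V' → β → List Token} (hf : Emits Γ f) (π : β → α) (ι : V → V')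
    (h : ∀ v b, Γ' (ι v) b = Γ v (π b)) : Emits Γ' fun b => f (π b) := by
  obtain ⟨p, hp, hP⟩ := hf
  refine ⟨p, fun b n hn => hp _ n fun v => by rw [← h]; exact hn _,
    fun loc d out hloc hout hne => ?_⟩
  obtain ⟨P, hP⟩ := hP (fun v => loc (ι v)) d out (fun v => hloc _) hout (fun v => hne _)
  exact ⟨P, fun b n L s hn hs => hP (π b) n L s (fun v => by rw [← h]; exact hn _)
    fun v => by rw [← h]; exact hs _⟩

theorem weaken (hf : Emits Γ f) : Emits (extend Γ N) fun x => f x.1 :=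
  hf.comap Sigma.fst some fun _ _ => rfl

theorem flatMap_finRange (hN : EmitsNat Γ N) {f : ∀ a, Fin (N a) → List Token}
    (hf : Emits (extend Γ N) fun x => f x.1 x.2) :
    Emits Γ fun a => (List.finRange (N a)).flatMap (f a) :=
  flatMap_symbols (sym := fun _ _ => .tick) (hN.congr fun a => by simp) (fun _ => hf)

theorem flatMap_finRange_succ (hN : EmitsNat Γ N) {f : ∀ a, Fin (N a + 1) → List Token}
    (h0 : Emits Γ fun a => f a 0) (hf : Emits (extend Γ N) fun x => f x.1 x.2.succ) :
    Emits Γ fun a => (List.finRange (N a + 1)).flatMap (f a) :=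
  (h0.append (flatMap_finRange hN (f := fun a i => f a i.succ) hf)).congr fun a => by
    simp [List.finRange_succ, List.flatMap_map]

theorem flatMap_finRange_add_three (hN : EmitsNat Γ N) {f : ∀ a, Fin (N a + 3) → List Token}
    (h0 : Emits Γ fun a => f a 0) (h1 : Emits Γ fun a => f a (Fin.succ 0))
    (h2 : Emits Γ fun a => f a (Fin.succ (Fin.succ 0)))
    (hf : Emits (extend Γ N) fun x => f x.1 x.2.succ.succ.succ) :
    Emits Γ fun a => (List.finRange (N a + 3)).flatMap (f a) :=
  (h0.append (h1.append (h2.append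
    (flatMap_finRange hN (f := fun a i => f a i.succ.succ.succ) hf)))).congr fun a => by
    simp [List.finRange_succ, List.flatMap_map]

theorem ite_le (hM : EmitsNat Γ M) (hN : EmitsNat Γ N) (hf : Emits Γ f) (hg : Emits Γ g) :
    Emits Γ fun a => if M a ≤ N a then f a else g a :=
  (ite_length_le hM hN hf hg).congr fun a => by simp

theorem ite_eq (hM : EmitsNat Γ M) (hN : EmitsNat Γ N) (hf : Emits Γ f) (hg : Emits Γ g) :
    Emits Γ fun a => if M a = N a then f a else g a :=
  (ite_le hM hN (ite_le hN hM hf hg) hg).congr fun a => by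
    simp only [le_antisymm_iff]
    split_ifs <;> tauto

theorem filter (p : Token → Bool) (hf : Emits Γ f) : Emits Γ fun a => (f a).filter p := by
  refine (flatMap_symbols (N := fun a => (f a).length) (sym := fun a i => (f a)[i])
    (g := fun c _ => if p c then [c] else []) (hf.congr fun a => by simp) fun c => ?_).congr
    fun a => ?_
  · exact const _
  · have : (f a).filter p = (f a).flatMap fun c => if p c then [c] else [] := by
      induction f a with
      | nil => rfl
      | cons c l ih =>
        rw [List.flatMap_cons, ← ih, List.filter_cons]
        split_ifs <;> rfl
    rw [this]
    conv_lhs => rw [← List.map_getElem_finRange (f a)]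
    rw [List.flatMap_map]
    rfl

end Emits

namespace EmitsNat

variable {V α : Type} {Γ : V → α → List Token} {M N : α → ℕ}

theorem const (n : ℕ) : EmitsNat Γ fun _ => n := Emits.const _

theorem add (hM : EmitsNat Γ M) (hN : EmitsNat Γ N) : EmitsNat Γ fun a => M a + N a :=
  (hM.append hN).congr fun a => by simp

theorem weaken (hM : EmitsNat Γ M) : EmitsNat (Emits.extend Γ N) fun x => M x.1 :=
  Emits.weaken hM

theorem mul (hM : EmitsNat Γ M) (hN : EmitsNat Γ N) : EmitsNat Γ fun a => M a * N a := by
  refine (Emits.flatMap_finRange hM (f := fun a _ => List.replicate (N a) .tick)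
    hN.weaken).congr fun a => (List.eq_replicate_iff.2 ⟨?_, ?_⟩).symm
  · simp [List.length_flatMap]
  · simp

theorem index : EmitsNat (Emits.extend Γ N) fun x => x.2 := Emits.var (Γ := Emits.extend Γ N) none

end EmitsNat

namespace Emits

variable {V α : Type} {Γ : V → α → List Token} {w : α → List Token} {k N : α → ℕ}

theorem count_take (hw : Emits Γ w) (hk : EmitsNat Γ k) :
    EmitsNat Γ fun a => ((w a).take (k a)).count .sep := by
  refine (flatMap_symbols (N := fun a => (w a).length) (sym := fun a i => (w a)[i])
    (g := fun c y => if c = .sep then if (y.2 : ℕ) + 1 ≤ k y.1 then [.tick] else [] else [])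
    (hw.congr fun a => by simp) fun c => ?_).congr fun a => count_take_sep_eq_flatMap _ _
  split_ifs
  · exact ite_le (EmitsNat.index.add (.const 1)) hk.weaken (const _) (const _)
  · exact const _

theorem piece (hw : Emits Γ w) (hk : EmitsNat Γ k) : Emits Γ fun a => piece (w a) (k a) := by
  refine (flatMap_symbols (N := fun a => (w a).length) (sym := fun a i => (w a)[i])
    (g := fun c y => if ((w y.1).take y.2).count .sep = k y.1 then [c] else [])
    (hw.congr fun a => by simp) fun c => ?_).congr fun a => piece_eq_flatMap _ _
  exact ite_eq (count_take hw.weaken EmitsNat.index) hk.weaken (const _) (const _)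

section Weights

variable {x : α → BigOInstance} (hx : Emits Γ fun a => encodeInstance (x a))
include hx

theorem emitsNat_s : EmitsNat Γ fun a => (x a).s :=
  ((hx.piece (.const 0)).filter (· = .tick)).congr fun a => by
    rw [piece_encodeInstance (k := 0) (c := List.replicate (x a).s .tick ++ [.sep]) rfl]
    simp

theorem emitsNat_m : EmitsNat Γ fun a => (x a).m :=
  ((hx.piece (.const 1)).filter (· = .tick)).congr fun a => by
    rw [piece_encodeInstance (k := 1) (c := List.replicate (x a).m .tick ++ [.sep]) rfl]
    simp

theorem emitsNat_n : EmitsNat Γ fun a => (x a).n :=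
  ((hx.piece (.const 2)).filter (· = .tick)).congr fun a => by
    rw [piece_encodeInstance (k := 2) (c := List.replicate (x a).n .tick ++ [.sep]) rfl]
    simp

theorem weight_A_I {p : ∀ a, Fin (x a).m} (hp : EmitsNat Γ fun a => p a) :
    Emits Γ fun a => encodeWeight ((x a).A.I (p a)) :=
  (hx.piece ((EmitsNat.const 3).add hp)).congr fun _ =>
    (piece_encodeInstance_A (automatonPieces_I _ _)).symm

theorem weight_A_F {p : ∀ a, Fin (x a).m} (hp : EmitsNat Γ fun a => p a) :
    Emits Γ fun a => encodeWeight ((x a).A.F (p a)) :=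
  (hx.piece ((EmitsNat.const 3).add (hx.emitsNat_m.add hp))).congr fun _ =>
    (piece_encodeInstance_A (automatonPieces_F _ _)).symm

theorem weight_A_M {l : ∀ a, Fin (x a).s} {p q : ∀ a, Fin (x a).m} (hl : EmitsNat Γ fun a => l a)
    (hp : EmitsNat Γ fun a => p a) (hq : EmitsNat Γ fun a => q a) :
    Emits Γ fun a => encodeWeight ((x a).A.M (l a) (p a) (q a)) :=
  have hm := hx.emitsNat_m
  (hx.piece ((EmitsNat.const 3).add ((hm.add hm).add ((hl.mul (hm.mul hm)).add
    ((hp.mul hm).add hq))))).congr fun _ =>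
    (piece_encodeInstance_A (automatonPieces_M _ _ _ _)).symm

/-- The offset skips the three cardinalities and the `m + m + s * (m * m)` entries of the first
automaton. -/
theorem weight_B {k : α → ℕ} {y : α → NMax} (hk : EmitsNat Γ k)
    (h : ∀ a, (automatonPieces (x a).B)[k a]? = some (encodeWeight (y a))) :
    Emits Γ fun a => encodeWeight (y a) :=
  have hm := hx.emitsNat_m
  (hx.piece (((EmitsNat.const 3).add ((hm.add hm).add (hx.emitsNat_s.mul (hm.mul hm)))).add
    hk)).congr fun a => (piece_encodeInstance_B (h a)).symm

theorem weight_B_I {p : ∀ a, Fin (x a).n} (hp : EmitsNat Γ fun a => p a) :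
    Emits Γ fun a => encodeWeight ((x a).B.I (p a)) :=
  hx.weight_B hp fun _ => automatonPieces_I _ _

theorem weight_B_F {p : ∀ a, Fin (x a).n} (hp : EmitsNat Γ fun a => p a) :
    Emits Γ fun a => encodeWeight ((x a).B.F (p a)) :=
  hx.weight_B (hx.emitsNat_n.add hp) fun _ => automatonPieces_F _ _

theorem weight_B_M {l : ∀ a, Fin (x a).s} {p q : ∀ a, Fin (x a).n} (hl : EmitsNat Γ fun a => l a)
    (hp : EmitsNat Γ fun a => p a) (hq : EmitsNat Γ fun a => q a) :
    Emits Γ fun a => encodeWeight ((x a).B.M (l a) (p a) (q a)) :=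
  have hn := hx.emitsNat_n
  hx.weight_B ((hn.add hn).add ((hl.mul (hn.mul hn)).add ((hp.mul hn).add hq)))
    fun _ => automatonPieces_M _ _ _ _

end Weights

theorem weight_boost {y : α → NMax} (hy : Emits Γ fun a => encodeWeight (y a)) :
    Emits Γ fun a => encodeWeight (MaxPlusAutomaton.boost (y a)) :=
  (ite_length_le (hy.filter _) nil ((symbol _).append hy) hy).congr fun _ => encodeWeight_boost _

open MaxPlusAutomaton

/-- The outer index `t` is the target prescribed by the letter. Splitting each of the three indices
into hub and other states leaves eight cases; the mask or the border determines all but three of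
them. -/
theorem masked_bordered (hN : EmitsNat Γ N) {h f : ∀ a, Fin (N a) → NMax}
    {D : ∀ a, Matrix (Fin (N a)) (Fin (N a)) NMax}
    (hh : Emits (extend Γ N) fun y => encodeWeight (h y.1 y.2))
    (hf : Emits (extend Γ N) fun y => encodeWeight (f y.1 y.2))
    (hD : Emits (extend (extend Γ N) fun y => N y.1) fun z => encodeWeight (D z.1.1 z.1.2 z.2)) :
    Emits Γ fun a => (List.finRange (N a + 1)).flatMap fun t =>
      (List.finRange (N a + 1)).flatMap fun p => (List.finRange (N a + 1)).flatMap fun q =>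
        encodeWeight (if q = t then bordered (h a) (f a) (D a) p q else ⊥) := by
  have hbot : ∀ {W β : Type} {Δ : W → β → List Token}, Emits Δ fun _ => encodeWeight ⊥ :=
    const _
  refine flatMap_finRange_succ hN (flatMap_finRange_succ hN (flatMap_finRange_succ hN ?_ ?_)
    (flatMap_finRange_succ hN.weaken ?_ ?_)) (flatMap_finRange_succ hN.weaken
    (flatMap_finRange_succ hN.weaken ?_ ?_) (flatMap_finRange_succ hN.weaken.weaken ?_ ?_))
  · exact hbot.congr fun a => rfl
  · exact hbot.congr fun a => by simp [Fin.succ_ne_zero]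
  · exact hf.congr fun a => rfl
  · exact hbot.congr fun a => by simp [Fin.succ_ne_zero]
  · exact hbot.congr fun a => by simp [(Fin.succ_ne_zero _).symm]
  -- The weights from the hub do not depend on `t`, so its loop counter is dropped from the context.
  · refine (ite_eq EmitsNat.index EmitsNat.index.weaken (hh.comap (fun z => ⟨z.1.1, z.2⟩)
      (fun v => v.elim none fun v => some (some v)) ?_) hbot).congr fun a => ?_
    · rintro (_ | v) b <;> rfl
    · simp only [Fin.succ_inj]
      simp only [Fin.ext_iff]
      split_ifs <;> rfl
  · exact hbot.congr fun a => by simp [(Fin.succ_ne_zero _).symm]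
  · refine (ite_eq EmitsNat.index EmitsNat.index.weaken.weaken (hD.comap
      (fun z => ⟨⟨z.1.1.1, z.1.2⟩, z.2⟩)
      (fun v => v.elim none fun v => some (v.elim none fun v => some (some v))) ?_)
      hbot).congr fun a => ?_
    · rintro (_ | _ | v) b <;> rfl
    · simp only [Fin.succ_inj]
      simp only [Fin.ext_iff]
      split_ifs <;> rfl

theorem padded (hN : EmitsNat Γ N) {h f : ∀ a, Fin (N a) → NMax}
    {D : ∀ a, Matrix (Fin (N a)) (Fin (N a)) NMax}
    (hh : Emits (extend Γ N) fun y => encodeWeight (h y.1 y.2))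
    (hf : Emits (extend Γ N) fun y => encodeWeight (f y.1 y.2))
    (hD : Emits (extend (extend Γ N) fun y => N y.1) fun z => encodeWeight (D z.1.1 z.1.2 z.2)) :
    Emits Γ fun a => (List.finRange (N a + 3)).flatMap fun p =>
      (List.finRange (N a + 3)).flatMap fun q =>
        encodeWeight (MaxPlusAutomaton.padded (h a) (f a) (D a) p q) := by
  have hc : ∀ {W β : Type} {Δ : W → β → List Token} (y : NMax), Emits Δ fun _ => encodeWeight y :=
    fun _ => const _
  exact flatMap_finRange_add_three hN
    (flatMap_finRange_add_three hN (hc 0) (hc ⊥) (hc ⊥) hh)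
    (flatMap_finRange_add_three hN (hc ⊥) (hc 1) (hc ⊥) (hc ⊥))
    (flatMap_finRange_add_three hN (hc ⊥) (hc ⊥) (hc 1) (hc ⊥))
    (flatMap_finRange_add_three hN.weaken hf (hc ⊥) (hc ⊥) hD)

end Emits

/-! ### The reduction on instances and the conclusion. -/

namespace BigOInstance

open MaxPlusAutomaton

/-- The instance of the simplified problem that is equivalent to a given instance. -/
def simplify (x : BigOInstance) : BigOInstance where
  s := (x.s + 3) * (x.m + 1)
  m := x.m + 1
  n := x.n + 3
  A := x.A.determinized _ finProdFinEquiv.symm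
  B := x.B.totalized.relabel fun l => (finProdFinEquiv.symm l).1

theorem simplify_mem_simplifiedInputs (x : BigOInstance) : x.simplify ∈ simplifiedInputs :=
  ⟨determinized_isTrim finProdFinEquiv.symm.surjective,
    totalized_isTrim finProdFinEquiv.symm.surjective, determinized_isDeterministic,
    totalized_weight_ne_bot⟩

theorem simplify_mem_bigOYes_iff (x : BigOInstance) : x.simplify ∈ bigOYes ↔ x ∈ bigOYes :=
  determinized_isBigO_iff finProdFinEquiv.symm.surjective

theorem emits_encode_simplify :
    Emits (fun _ : Unit => encodeInstance) fun x => encodeInstance x.simplify := by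
  have hx : Emits (fun _ : Unit => encodeInstance) fun x => encodeInstance x :=
    Emits.var (Γ := fun _ : Unit => encodeInstance) ()
  have hs := hx.emitsNat_s
  have hm := hx.emitsNat_m
  have hn := hx.emitsNat_n
  have hm1 := hm.add (.const 1)
  have hn3 := hn.add (.const 3)
  have hc : ∀ {W β : Type} {Δ : W → β → List Token} (y : NMax), Emits Δ fun _ => encodeWeight y :=
    fun _ => .const _
  have hsep : ∀ {W β : Type} {Δ : W → β → List Token}, Emits Δ fun _ => [Token.sep] :=
    Emits.symbol _
  have hvA : Emits (fun _ : Unit => encodeInstance) fun x =>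
      (List.finRange (x.m + 1)).flatMap fun p => encodeWeight (x.simplify.A.I p) :=
    Emits.flatMap_finRange_succ hm (hc 0) (hc ⊥)
  have hvI : Emits (fun _ : Unit => encodeInstance) fun x =>
      (List.finRange (x.n + 3)).flatMap fun p => encodeWeight (x.simplify.B.I p) :=
    Emits.flatMap_finRange_add_three hn (hc 0) (hc 0) (hc ⊥) (hc ⊥)
  have hvF : Emits (fun _ : Unit => encodeInstance) fun x =>
      (List.finRange (x.n + 3)).flatMap fun p => encodeWeight (x.simplify.B.F p) :=
    Emits.flatMap_finRange_add_three hn (hc 0) (hc ⊥) (hc 0) (hc ⊥)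
  have hMA : Emits (fun _ : Unit => encodeInstance) fun x =>
      (List.finRange (x.s + 3)).flatMap fun k => (List.finRange (x.m + 1)).flatMap fun t =>
        (List.finRange (x.m + 1)).flatMap fun p => (List.finRange (x.m + 1)).flatMap fun q =>
          encodeWeight (if q = t then x.A.hubMatrix k p q else ⊥) := by
    refine Emits.flatMap_finRange_add_three hs ?_ ?_ ?_ ?_
    · exact Emits.masked_bordered hm (hx.weaken.weight_A_I .index) (hc ⊥) (hc ⊥)
    · exact Emits.masked_bordered hm (hc ⊥) (hx.weaken.weight_A_F .index).weight_boost (hc ⊥)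
    · refine Emits.flatMap_finRange hm1 (Emits.flatMap_finRange hm1.weaken
        (Emits.flatMap_finRange hm1.weaken.weaken ?_))
      refine (Emits.ite_eq EmitsNat.index EmitsNat.index.weaken.weaken (hc 0) (hc ⊥)).congr
        fun a => ?_
      simp only [Fin.ext_iff]
      split_ifs <;> rfl
    · exact Emits.masked_bordered hm.weaken (hc ⊥) (hc ⊥)
        (hx.weaken.weaken.weaken.weight_A_M EmitsNat.index.weaken.weaken EmitsNat.index.weaken
          .index)
  have hMB : Emits (fun _ : Unit => encodeInstance) fun x =>
      (List.finRange (x.s + 3)).flatMap fun k => (List.finRange (x.m + 1)).flatMap fun _ =>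
        (List.finRange (x.n + 3)).flatMap fun p => (List.finRange (x.n + 3)).flatMap fun q =>
          encodeWeight (x.B.totalized.M k p q) := by
    refine Emits.flatMap_finRange_add_three hs ?_ ?_ ?_ ?_
    · exact Emits.flatMap_finRange hm1 (Emits.padded hn.weaken
        (hx.weaken.weaken.weight_B_I .index) (hc ⊥) (hc ⊥))
    · exact Emits.flatMap_finRange hm1 (Emits.padded hn.weaken (hc ⊥)
        (hx.weaken.weaken.weight_B_F .index).weight_boost (hc ⊥))
    · exact Emits.flatMap_finRange hm1 (Emits.flatMap_finRange hn3.weaken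
        (Emits.flatMap_finRange hn3.weaken.weaken (hc 1)))
    · exact Emits.flatMap_finRange hm1.weaken (Emits.padded hn.weaken.weaken (hc ⊥) (hc ⊥)
        (hx.weaken.weaken.weaken.weaken.weight_B_M EmitsNat.index.weaken.weaken.weaken
          EmitsNat.index.weaken .index))
  -- The term `hvA` occurs twice because the initial and final vectors of the deterministic
  -- automaton coincide. A letter of the product alphabet is enumerated with the mark as outer and
  -- the target as inner index, which is how `flatMap_finRange_mul` splits the loop.
  refine (((((((((hs.add (.const 3)).mul hm1).append hsep).append hm1).append hsep).append
    hn3).append hsep).append ((hvA.append hvA).append hMA)).append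
    ((hvI.append hvF).append hMB)).congr fun x => ?_
  simp only [encodeInstance, encodeAutomaton, simplify]
  rw [flatMap_finRange_mul, flatMap_finRange_mul]
  simp only [determinized, relabel, Equiv.symm_apply_apply]

end BigOInstance

theorem mainTheorem4 (h : SimplifiedBigOProblemInPSPACE) : BigOProblemInPSPACE :=
  h.of_reduction BigOInstance.emits_encode_simplify
    (fun x _ => x.simplify_mem_simplifiedInputs) (fun x _ => x.simplify_mem_bigOYes_iff)
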